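/- Let $I=[0,1]$ and let $C(I)$ be the space of continuous functions $f\colon I\to\mathbb{R}$ with the supremum norm. A subset of a topological space is \emph{residual} if its complement is a countable union of nowhere dense sets. The Dini derivatives of $f$ are the extended real numbers \[ D^{+}f(x)=\limsup_{y\downarrow x}\frac{f(y)-f(x)}{y-x},\quad D_{+}f(x)=\liminf_{y\downarrow x}\frac{f(y)-f(x)}{y-x}\qquad(0\le x<1), \] \[ D^{-}f(x)=\limsup_{y\uparrow x}\frac{f(y)-f(x)}{y-x},\quad D_{-}f(x)=\liminf_{y\uparrow x}\frac{f(y)-f(x)}{y-x}\qquad(0<x\le 1). \] A point $x\in I$ is a \emph{knot point} of $f$ if either $x\in(0,1)$, $D^+f(x)=D^-f(x)=\infty$ and $D_+f(x)=D_-f(x)=-\infty$; or $x=0$, $D^+f(x)=\infty$ and $D_+f(x)=-\infty$; or $x=1$, $D^-f(x)=\infty$ and $D_-f(x)=-\infty$. Let $N(f)$ be the set of all points of $I$ that are not knot points of $f$. Let $\mathcal{K}$ be the set of all closed subsets of $I$ (including $\emptyset$) with the Hausdorff metric, where the distance from $\emptyset$ to every nonempty closed set is defined to be $1$, and give the set $\mathcal{K}^{\mathbb{N}}$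 of sequences in $\mathcal{K}$ the product topology. Let $\mathcal{F}_\sigma$ be the family of all $F_\sigma$ subsets of $I$. A subfamily $\mathcal{F}\subset\mathcal{F}_\sigma$ is called \emph{residual in $\mathcal{F}_\sigma$} if $\{(K_n)\in\mathcal{K}^{\mathbb{N}} : \bigcup_n K_n\in\mathcal{F}\}$ is residual in $\mathcal{K}^{\mathbb{N}}$. \textbf{Theorem.} For every family $\mathcal{S}$ of subsets of $I$, the following are equivalent: \begin{enumerate} \item the set $\{f\in C(I) : N(f)\in\mathcal{S}\}$ is residual in $C(I)$; \item $\mathcal{S}\cap\mathcal{F}_\sigma$ is residual in $\mathcal{F}_\sigma$. \end{enumerate} -/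

import Mathlib

open Filter Topology TopologicalSpace

noncomputable section

namespace KnotPoints

/-- The unit interval `[0,1]`. -/
abbrev I : Type := unitInterval

/-- The difference quotient `(f y - f x) / (y - x)`, as an extended real number. -/
def diffQuot (f : C(I, ℝ)) (x y : I) : EReal :=
  (((f y - f x) / ((y : ℝ) - (x : ℝ)) : ℝ) : EReal)

/-- Upper right Dini derivative `D^+ f(x)` (meaningful for `x < 1`). -/
def diniUpperRight (f : C(I, ℝ)) (x : I) : EReal :=
  limsup (fun y : I => diffQuot f x y) (𝓝[>] x)

/-- Lower right Dini derivative `D_+ f(x)` (meaningful for `x < 1`). -/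
def diniLowerRight (f : C(I, ℝ)) (x : I) : EReal :=
  liminf (fun y : I => diffQuot f x y) (𝓝[>] x)

/-- Upper left Dini derivative `D^- f(x)` (meaningful for `0 < x`). -/
def diniUpperLeft (f : C(I, ℝ)) (x : I) : EReal :=
  limsup (fun y : I => diffQuot f x y) (𝓝[<] x)

/-- Lower left Dini derivative `D_- f(x)` (meaningful for `0 < x`). -/
def diniLowerLeft (f : C(I, ℝ)) (x : I) : EReal :=
  liminf (fun y : I => diffQuot f x y) (𝓝[<] x)

/-- `x` is a knot point of `f`: every upper (lower) Dini derivative of `f` that is defined at `x`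
is `+∞` (`-∞`). -/
def IsKnotPoint (f : C(I, ℝ)) (x : I) : Prop :=
  (0 < x ∧ x < 1 ∧ diniUpperRight f x = ⊤ ∧ diniUpperLeft f x = ⊤ ∧
      diniLowerRight f x = ⊥ ∧ diniLowerLeft f x = ⊥) ∨
    (x = 0 ∧ diniUpperRight f x = ⊤ ∧ diniLowerRight f x = ⊥) ∨
    (x = 1 ∧ diniUpperLeft f x = ⊤ ∧ diniLowerLeft f x = ⊥)

/-- `N(f)`: the set of points of `[0,1]` that are not knot points of `f`. -/
def nonKnot (f : C(I, ℝ)) : Set I := {x | ¬ IsKnotPoint f x}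

/-- The family of all `F_σ` subsets of `[0,1]`. -/
def Fsigma : Set (Set I) := {A | ∃ K : ℕ → Closeds I, A = ⋃ n, (K n : Set I)}

/-- Residuality of a family `F` of `F_σ` sets: the sequences of closed sets whose union belongs to
`F` form a residual subset of the product space of sequences. `Closeds I` carries the topology of
the Hausdorff (extended) distance; `∅` is at distance `∞` from every nonempty closed set, which
induces the same topology as giving that distance the value `1`. -/
def ResidualFamily (F : Set (Set I)) : Prop :=
  {K : ℕ → Closeds I | (⋃ n, (K n : Set I)) ∈ F} ∈ residual (ℕ → Closeds I)

end KnotPoints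

end

namespace KnotPoints

/-! ### Points where a one-sided difference quotient is bounded on one side -/

/-- The points `x` at which `σ (f y - f x) ≤ c |y - x|` for all `y` in the window of length `1 / c`
on the side `d` of `x`, the window being contained in `[0,1]`. -/
def boundedAt (σ d c : ℝ) (f : C(I, ℝ)) : Set I :=
  {x | (x : ℝ) + d / c ∈ Set.Icc (0 : ℝ) 1 ∧
    ∀ y : I, 0 < d * ((y : ℝ) - x) → d * ((y : ℝ) - x) < 1 / c →
      σ * (f y - f x) ≤ c * (d * ((y : ℝ) - x))}

/-- The union of `boundedAt σ d c f` over all signs `σ` and `d`. -/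
def boundedSet (c : ℝ) (f : C(I, ℝ)) : Set I :=
  {x | ∃ σ d : ℝ, (σ = 1 ∨ σ = -1) ∧ (d = 1 ∨ d = -1) ∧ x ∈ boundedAt σ d c f}

lemma isClosed_boundedAt (σ d c : ℝ) (f : C(I, ℝ)) : IsClosed (boundedAt σ d c f) := by
  have h : boundedAt σ d c f = {x : I | (x : ℝ) + d / c ∈ Set.Icc (0 : ℝ) 1} ∩
      ⋂ y : I, {x : I | 0 < d * ((y : ℝ) - x) → d * ((y : ℝ) - x) < 1 / c →
        σ * (f y - f x) ≤ c * (d * ((y : ℝ) - x))} := by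
    ext x; simp [boundedAt]
  rw [h]
  refine IsClosed.inter (isClosed_Icc.preimage (by fun_prop)) (isClosed_iInter fun y => ?_)
  refine isClosed_imp (isOpen_lt (by fun_prop) (by fun_prop)) ?_
  exact isClosed_imp (isOpen_lt (by fun_prop) (by fun_prop))
    (isClosed_le (by fun_prop) (by fun_prop))

lemma isClosed_boundedSet (c : ℝ) (f : C(I, ℝ)) : IsClosed (boundedSet c f) := by
  have h : boundedSet c f = (boundedAt 1 1 c f ∪ boundedAt 1 (-1) c f) ∪
      (boundedAt (-1) 1 c f ∪ boundedAt (-1) (-1) c f) := by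
    ext x
    constructor
    · rintro ⟨σ, d, rfl | rfl, rfl | rfl, h⟩ <;> simp [h]
    · rintro ((h | h) | (h | h))
      exacts [⟨_, _, .inl rfl, .inl rfl, h⟩, ⟨_, _, .inl rfl, .inr rfl, h⟩,
        ⟨_, _, .inr rfl, .inl rfl, h⟩, ⟨_, _, .inr rfl, .inr rfl, h⟩]
  rw [h]
  exact ((isClosed_boundedAt _ _ _ _).union (isClosed_boundedAt _ _ _ _)).union
    ((isClosed_boundedAt _ _ _ _).union (isClosed_boundedAt _ _ _ _))

lemma boundedAt_mono {σ d c c' : ℝ} (hd : d = 1 ∨ d = -1) (hc : 0 < c) (h : c ≤ c')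
    (f : C(I, ℝ)) : boundedAt σ d c f ⊆ boundedAt σ d c' f := by
  rintro x ⟨hx, hy⟩
  have hle : 1 / c' ≤ 1 / c := one_div_le_one_div_of_le hc h
  have hpos : 0 < 1 / c' := one_div_pos.2 (hc.trans_le h)
  refine ⟨?_, fun y h0 h1 => (hy y h0 (h1.trans_le hle)).trans ?_⟩
  · have h0 := x.2.1
    have h1 := x.2.2
    rcases hd with rfl | rfl
    · exact ⟨by linarith, by linarith [hx.2]⟩
    · rw [neg_div] at hx ⊢
      exact ⟨by linarith [hx.1], by linarith⟩
  · exact mul_le_mul_of_nonneg_right h h0.le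

lemma boundedSet_mono {c c' : ℝ} (hc : 0 < c) (h : c ≤ c') (f : C(I, ℝ)) :
    boundedSet c f ⊆ boundedSet c' f := by
  rintro x ⟨σ, d, hσ, hd, hx⟩
  exact ⟨σ, d, hσ, hd, boundedAt_mono hd hc h f hx⟩

lemma limsup_coe_ne_top_iff {α : Type*} {l : Filter α} {u : α → ℝ} :
    limsup (fun y => (u y : EReal)) l ≠ ⊤ ↔ ∃ m : ℕ, ∀ᶠ y in l, u y ≤ m := by
  constructor
  · intro h
    obtain ⟨m, hm⟩ : ∃ m : ℕ, limsup (fun y => (u y : EReal)) l < ((m : ℝ) : EReal) := by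
      obtain ⟨r, hr, -⟩ := EReal.lt_iff_exists_real_btwn.1 (lt_top_iff_ne_top.2 h)
      obtain ⟨m, hm⟩ := exists_nat_ge r
      exact ⟨m, hr.trans_le (EReal.coe_le_coe_iff.2 hm)⟩
    refine ⟨m, (eventually_lt_of_limsup_lt hm).mono fun y hy => ?_⟩
    exact (EReal.coe_lt_coe_iff.1 hy).le
  · rintro ⟨m, hm⟩
    have : limsup (fun y => (u y : EReal)) l ≤ ((m : ℝ) : EReal) :=
      limsup_le_of_le (by isBoundedDefault) (hm.mono fun y hy => EReal.coe_le_coe_iff.2 hy)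
    exact (this.trans_lt (EReal.coe_lt_top _)).ne

lemma liminf_coe_ne_bot_iff {α : Type*} {l : Filter α} {u : α → ℝ} :
    liminf (fun y => (u y : EReal)) l ≠ ⊥ ↔ ∃ m : ℕ, ∀ᶠ y in l, -(m : ℝ) ≤ u y := by
  constructor
  · intro h
    obtain ⟨m, hm⟩ : ∃ m : ℕ, ((-(m : ℝ) : ℝ) : EReal) < liminf (fun y => (u y : EReal)) l := by
      obtain ⟨r, -, hr⟩ := EReal.lt_iff_exists_real_btwn.1 (bot_lt_iff_ne_bot.2 h)
      obtain ⟨m, hm⟩ := exists_nat_ge (-r)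
      exact ⟨m, (EReal.coe_le_coe_iff.2 (by linarith)).trans_lt hr⟩
    refine ⟨m, (eventually_lt_of_lt_liminf hm).mono fun y hy => ?_⟩
    exact (EReal.coe_lt_coe_iff.1 hy).le
  · rintro ⟨m, hm⟩
    have : ((-(m : ℝ) : ℝ) : EReal) ≤ liminf (fun y => (u y : EReal)) l :=
      le_liminf_of_le (by isBoundedDefault) (hm.mono fun y hy => EReal.coe_le_coe_iff.2 hy)
    exact ((EReal.bot_lt_coe _).trans_le this).ne'

lemma exists_boundedAt_right_iff {σ : ℝ} {f : C(I, ℝ)} {x : I} (hx : x < 1) :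
    (∃ m : ℕ, ∀ᶠ y in 𝓝[>] x, σ * (f y - f x) ≤ m * ((y : ℝ) - x)) ↔
      ∃ m : ℕ, x ∈ boundedAt σ 1 (m + 1) f := by
  have hx1 : (x : ℝ) < 1 := hx
  constructor
  · rintro ⟨m, hm⟩
    obtain ⟨ε, hε, h⟩ := Metric.mem_nhdsWithin_iff.1 hm
    obtain ⟨n, hn⟩ := exists_nat_gt (max (m : ℝ) (max (1 / ε) (1 / (1 - (x : ℝ)))))
    have hn1 : (m : ℝ) < n := (le_max_left _ _).trans_lt hn
    have hn2 : 1 / ε < n := ((le_max_left _ _).trans (le_max_right _ _)).trans_lt hn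
    have hn3 : 1 / (1 - (x : ℝ)) < n := ((le_max_right _ _).trans (le_max_right _ _)).trans_lt hn
    have h2 : 1 / ((n : ℝ) + 1) < ε := by
      rw [div_lt_comm₀ (by positivity) hε]; linarith
    have h3 : 1 / ((n : ℝ) + 1) < 1 - x := by
      rw [div_lt_comm₀ (by positivity) (by linarith)]; linarith
    have h0 : 0 < 1 / ((n : ℝ) + 1) := by positivity
    refine ⟨n, ⟨by linarith [x.2.1], by linarith⟩, fun y hy0 hy1 => ?_⟩
    rw [one_mul] at hy0 hy1 ⊢
    have : σ * (f y - f x) ≤ m * ((y : ℝ) - x) := by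
      refine h ⟨?_, ?_⟩
      · rw [Metric.mem_ball, Subtype.dist_eq, Real.dist_eq, abs_of_pos hy0]
        linarith
      · exact sub_pos.1 hy0
    exact this.trans (mul_le_mul_of_nonneg_right (by linarith) hy0.le)
  · rintro ⟨m, -, h⟩
    refine ⟨m + 1, Metric.mem_nhdsWithin_iff.2 ⟨1 / (m + 1), by positivity, ?_⟩⟩
    rintro y ⟨hy, hxy⟩
    have hxy' : (x : ℝ) < y := hxy
    rw [Metric.mem_ball, Subtype.dist_eq, Real.dist_eq, abs_of_pos (sub_pos.2 hxy')] at hy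
    simpa using h y (by linarith) (by linarith)

lemma exists_boundedAt_left_iff {σ : ℝ} {f : C(I, ℝ)} {x : I} (hx : 0 < x) :
    (∃ m : ℕ, ∀ᶠ y in 𝓝[<] x, σ * (f y - f x) ≤ m * ((x : ℝ) - y)) ↔
      ∃ m : ℕ, x ∈ boundedAt σ (-1) (m + 1) f := by
  have hx1 : 0 < (x : ℝ) := hx
  constructor
  · rintro ⟨m, hm⟩
    obtain ⟨ε, hε, h⟩ := Metric.mem_nhdsWithin_iff.1 hm
    obtain ⟨n, hn⟩ := exists_nat_gt (max (m : ℝ) (max (1 / ε) (1 / (x : ℝ))))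
    have hn1 : (m : ℝ) < n := (le_max_left _ _).trans_lt hn
    have hn2 : 1 / ε < n := ((le_max_left _ _).trans (le_max_right _ _)).trans_lt hn
    have hn3 : 1 / (x : ℝ) < n := ((le_max_right _ _).trans (le_max_right _ _)).trans_lt hn
    have h2 : 1 / ((n : ℝ) + 1) < ε := by
      rw [div_lt_comm₀ (by positivity) hε]; linarith
    have h3 : 1 / ((n : ℝ) + 1) < x := by
      rw [div_lt_comm₀ (by positivity) (by linarith)]; linarith
    have h0 : 0 < 1 / ((n : ℝ) + 1) := by positivity
    refine ⟨n, ?_, fun y hy0 hy1 => ?_⟩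
    · rw [neg_div]
      exact ⟨by linarith, by linarith [x.2.2]⟩
    have : σ * (f y - f x) ≤ m * ((x : ℝ) - y) := by
      refine h ⟨?_, ?_⟩
      · rw [Metric.mem_ball, dist_comm, Subtype.dist_eq, Real.dist_eq, abs_of_pos (by linarith)]
        linarith
      · exact sub_pos.1 (by linarith : 0 < (x : ℝ) - y)
    have e : -1 * ((y : ℝ) - x) = x - y := by ring
    rw [e] at hy0 ⊢
    exact this.trans (mul_le_mul_of_nonneg_right (by linarith) hy0.le)
  · rintro ⟨m, -, h⟩
    refine ⟨m + 1, Metric.mem_nhdsWithin_iff.2 ⟨1 / (m + 1), by positivity, ?_⟩⟩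
    rintro y ⟨hy, hxy⟩
    have hxy' : (y : ℝ) < x := hxy
    rw [Metric.mem_ball, dist_comm, Subtype.dist_eq, Real.dist_eq,
      abs_of_pos (sub_pos.2 hxy')] at hy
    have := h y (by linarith) (by linarith)
    simpa using this

lemma diniUpperRight_ne_top_iff {f : C(I, ℝ)} {x : I} (hx : x < 1) :
    diniUpperRight f x ≠ ⊤ ↔ ∃ m : ℕ, x ∈ boundedAt 1 1 (m + 1) f := by
  rw [← exists_boundedAt_right_iff hx, diniUpperRight]
  unfold diffQuot
  rw [limsup_coe_ne_top_iff]
  refine exists_congr fun m => eventually_congr (eventually_mem_nhdsWithin.mono fun y hy => ?_)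
  have hy' : 0 < (y : ℝ) - x := sub_pos.2 hy
  rw [div_le_iff₀ hy', one_mul]

lemma diniLowerRight_ne_bot_iff {f : C(I, ℝ)} {x : I} (hx : x < 1) :
    diniLowerRight f x ≠ ⊥ ↔ ∃ m : ℕ, x ∈ boundedAt (-1) 1 (m + 1) f := by
  rw [← exists_boundedAt_right_iff hx, diniLowerRight]
  unfold diffQuot
  rw [liminf_coe_ne_bot_iff]
  refine exists_congr fun m => eventually_congr (eventually_mem_nhdsWithin.mono fun y hy => ?_)
  have hy' : 0 < (y : ℝ) - x := sub_pos.2 hy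
  rw [le_div_iff₀ hy']
  constructor <;> intro h <;> linarith

lemma diniUpperLeft_ne_top_iff {f : C(I, ℝ)} {x : I} (hx : 0 < x) :
    diniUpperLeft f x ≠ ⊤ ↔ ∃ m : ℕ, x ∈ boundedAt (-1) (-1) (m + 1) f := by
  rw [← exists_boundedAt_left_iff hx, diniUpperLeft]
  unfold diffQuot
  rw [limsup_coe_ne_top_iff]
  refine exists_congr fun m => eventually_congr (eventually_mem_nhdsWithin.mono fun y hy => ?_)
  have hy' : (y : ℝ) - x < 0 := sub_neg.2 hy
  rw [div_le_iff_of_neg hy']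
  constructor <;> intro h <;> linarith

lemma diniLowerLeft_ne_bot_iff {f : C(I, ℝ)} {x : I} (hx : 0 < x) :
    diniLowerLeft f x ≠ ⊥ ↔ ∃ m : ℕ, x ∈ boundedAt 1 (-1) (m + 1) f := by
  rw [← exists_boundedAt_left_iff hx, diniLowerLeft]
  unfold diffQuot
  rw [liminf_coe_ne_bot_iff]
  refine exists_congr fun m => eventually_congr (eventually_mem_nhdsWithin.mono fun y hy => ?_)
  have hy' : (y : ℝ) - x < 0 := sub_neg.2 hy
  rw [le_div_iff_of_neg hy']
  constructor <;> intro h <;> linarith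

lemma lt_one_of_mem_boundedAt {σ c : ℝ} (hc : 0 < c) {f : C(I, ℝ)} {x : I}
    (h : x ∈ boundedAt σ 1 c f) : x < 1 := by
  have h0 : 0 < 1 / c := one_div_pos.2 hc
  have : (x : ℝ) < 1 := by linarith [h.1.2]
  exact this

lemma pos_of_mem_boundedAt {σ c : ℝ} (hc : 0 < c) {f : C(I, ℝ)} {x : I}
    (h : x ∈ boundedAt σ (-1) c f) : 0 < x := by
  have h0 : 0 < 1 / c := one_div_pos.2 hc
  have h1 := h.1.1
  rw [neg_div] at h1
  have : 0 < (x : ℝ) := by linarith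
  exact this

/-- The set of non-knot points is the increasing union of the sets `boundedSet (m + 1) f`. -/
theorem nonKnot_eq_iUnion_boundedSet (f : C(I, ℝ)) :
    nonKnot f = ⋃ m : ℕ, boundedSet (m + 1) f := by
  ext x
  rw [Set.mem_iUnion]
  constructor
  · intro hx
    by_contra! hcon
    refine hx ?_
    have hn : ∀ σ d : ℝ, (σ = 1 ∨ σ = -1) → (d = 1 ∨ d = -1) →
        ¬ ∃ m : ℕ, x ∈ boundedAt σ d (m + 1) f :=
      fun σ d hσ hd ⟨m, hm⟩ => hcon m ⟨σ, d, hσ, hd, hm⟩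
    have hR (h : x < 1) : diniUpperRight f x = ⊤ ∧ diniLowerRight f x = ⊥ :=
      ⟨not_not.1 fun h' => hn _ _ (.inl rfl) (.inl rfl) ((diniUpperRight_ne_top_iff h).1 h'),
        not_not.1 fun h' => hn _ _ (.inr rfl) (.inl rfl) ((diniLowerRight_ne_bot_iff h).1 h')⟩
    have hL (h : 0 < x) : diniUpperLeft f x = ⊤ ∧ diniLowerLeft f x = ⊥ :=
      ⟨not_not.1 fun h' => hn _ _ (.inr rfl) (.inr rfl) ((diniUpperLeft_ne_top_iff h).1 h'),
        not_not.1 fun h' => hn _ _ (.inl rfl) (.inr rfl) ((diniLowerLeft_ne_bot_iff h).1 h')⟩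
    rcases eq_or_ne x 0 with h0 | h0
    · exact .inr (.inl ⟨h0, hR (h0 ▸ zero_lt_one)⟩)
    rcases eq_or_ne x 1 with h1 | h1
    · exact .inr (.inr ⟨h1, hL (h1 ▸ zero_lt_one)⟩)
    have h0' : 0 < x := unitInterval.pos_iff_ne_zero.2 h0
    have h1' : x < 1 := unitInterval.lt_one_iff_ne_one.2 h1
    exact .inl ⟨h0', h1', (hR h1').1, (hL h0').1, (hR h1').2, (hL h0').2⟩
  · rintro ⟨m, σ, d, hσ, hd, hm⟩ hk
    have hc : (0 : ℝ) < m + 1 := by positivity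
    rcases hd with rfl | rfl
    · have hx := lt_one_of_mem_boundedAt hc hm
      have hkn : diniUpperRight f x = ⊤ ∧ diniLowerRight f x = ⊥ := by
        rcases hk with h | h | h
        exacts [⟨h.2.2.1, h.2.2.2.2.1⟩, h.2, absurd h.1 hx.ne]
      rcases hσ with rfl | rfl
      · exact (diniUpperRight_ne_top_iff hx).2 ⟨m, hm⟩ hkn.1
      · exact (diniLowerRight_ne_bot_iff hx).2 ⟨m, hm⟩ hkn.2
    · have hx := pos_of_mem_boundedAt hc hm
      have hkn : diniUpperLeft f x = ⊤ ∧ diniLowerLeft f x = ⊥ := by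
        rcases hk with h | h | h
        exacts [⟨h.2.2.2.1, h.2.2.2.2.2⟩, absurd h.1 hx.ne', h.2]
      rcases hσ with rfl | rfl
      · exact (diniLowerLeft_ne_bot_iff hx).2 ⟨m, hm⟩ hkn.2
      · exact (diniUpperLeft_ne_top_iff hx).2 ⟨m, hm⟩ hkn.1

/-- If `f` lies below the line of slope `c` through `(p, f p)` on a window of length `w` (with the
margin `μ` at distance at least `δ` from `p`), then every function close to `f` has a point of
`boundedAt σ d c` within distance `δ` of `p`. -/
theorem exists_mem_boundedAt_near {σ d c w δ μ : ℝ} (hσ : σ = 1 ∨ σ = -1) (hd : d = 1 ∨ d = -1)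
    (hc : 0 < c) {f f' : C(I, ℝ)} {p : I} (hw : (p : ℝ) + d * w ∈ Set.Icc (0 : ℝ) 1)
    (hδ : 0 < δ) (hcw : 1 / c + δ ≤ w)
    (hf : ∀ y : I, δ ≤ d * ((y : ℝ) - p) → d * ((y : ℝ) - p) ≤ w →
      σ * f y ≤ σ * f p + c * (d * ((y : ℝ) - p)) - μ)
    (hff' : ∀ y, |f' y - f y| < μ / 2) :
    ∃ x ∈ boundedAt σ d c f', dist x p < δ := by
  have hc' : 0 < 1 / c := one_div_pos.2 hc
  have hs (y : I) : |σ * f' y - σ * f y| < μ / 2 := by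
    have := hff' y
    rcases hσ with rfl | rfl
    · simpa using this
    · rw [← mul_sub, abs_mul]; simpa using this
  let S : Set I := {y | 0 ≤ d * ((y : ℝ) - p) ∧ d * ((y : ℝ) - p) ≤ w}
  have hS : IsCompact S := by
    have h : Continuous fun y : I => d * ((y : ℝ) - p) := by fun_prop
    exact ((isClosed_le continuous_const h).inter (isClosed_le h continuous_const)).isCompact
  have hpS : p ∈ S := by
    refine ⟨by simp, ?_⟩
    simp only [sub_self, mul_zero]; linarith
  obtain ⟨x, ⟨hx0, hxw⟩, hmax⟩ := hS.exists_isMaxOn ⟨p, hpS⟩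
    (f := fun y : I => σ * f' y - c * (d * ((y : ℝ) - p))) (by fun_prop)
  have hmax' : ∀ y ∈ S, σ * f' y - c * (d * ((y : ℝ) - p)) ≤ σ * f' x - c * (d * ((x : ℝ) - p)) :=
    fun y hy => hmax hy
  have hlt : d * ((x : ℝ) - p) < δ := by
    by_contra! hge
    have h1 := hf x hge hxw
    have h2 := hmax' p hpS
    simp only [sub_self, mul_zero, sub_zero] at h2
    have h3 := abs_lt.1 (hs x)
    have h4 := abs_lt.1 (hs p)
    linarith [h3.2, h4.1]
  have habs : dist x p = d * ((x : ℝ) - p) := by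
    rw [Subtype.dist_eq, Real.dist_eq]
    rcases hd with rfl | rfl
    · rw [one_mul] at hx0 ⊢; exact abs_of_nonneg hx0
    · rw [abs_of_nonpos (by linarith)]; ring
  refine ⟨x, ⟨?_, fun y hy0 hy1 => ?_⟩, habs ▸ hlt⟩
  · have hp := p.2
    rcases hd with rfl | rfl
    · simp only [one_mul] at *
      exact ⟨by linarith [x.2.1], by linarith [hw.2]⟩
    · rw [neg_div]
      exact ⟨by linarith [hw.1], by linarith [x.2.2]⟩
  · have hyS : y ∈ S := by
      have e : d * ((y : ℝ) - p) = d * ((y : ℝ) - x) + d * ((x : ℝ) - p) := by ring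
      exact ⟨by rw [e]; linarith, by rw [e]; linarith⟩
    have := hmax' y hyS
    linarith

/-! ### Basic open sets of sequences of closed sets -/

/-- The sequences `K` whose first `N` terms are covered by, and meet, all the `ρ`-balls around the
points of the corresponding finite set. -/
def vietoris (N : ℕ) (F : ℕ → Finset I) (ρ : ℝ) : Set (ℕ → Closeds I) :=
  {K | ∀ i < N, (K i : Set I) ⊆ ⋃ p ∈ F i, Metric.ball p ρ ∧
    ∀ p ∈ F i, ((K i : Set I) ∩ Metric.ball p ρ).Nonempty}

lemma isOpen_closeds_subset {O : Set I} (hO : IsOpen O) :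
    IsOpen {K : Closeds I | (K : Set I) ⊆ O} := by
  rw [EMetric.isOpen_iff]
  intro K hK
  obtain ⟨δ, hδ, hsub⟩ := K.isClosed.isCompact.exists_thickening_subset_open hO hK
  refine ⟨ENNReal.ofReal δ, ENNReal.ofReal_pos.2 hδ, fun K' hK' x hx => hsub ?_⟩
  have h : Metric.hausdorffEDist (K' : Set I) K < ENNReal.ofReal δ := hK'
  obtain ⟨y, hy, hxy⟩ := Metric.exists_edist_lt_of_hausdorffEDist_lt hx h
  refine Metric.mem_thickening_iff.2 ⟨y, hy, ?_⟩
  rwa [edist_dist, ENNReal.ofReal_lt_ofReal_iff hδ] at hxy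

lemma isOpen_vietoris (N : ℕ) (F : ℕ → Finset I) (ρ : ℝ) : IsOpen (vietoris N F ρ) := by
  have h : vietoris N F ρ = ⋂ i ∈ Set.Iio N,
      ({K : ℕ → Closeds I | (K i : Set I) ⊆ ⋃ p ∈ F i, Metric.ball p ρ} ∩
        ⋂ p ∈ F i, {K : ℕ → Closeds I | ((K i : Set I) ∩ Metric.ball p ρ).Nonempty}) := by
    ext K; simp [vietoris]
  rw [h]
  refine (Set.finite_Iio N).isOpen_biInter fun i _ => ?_
  have hc : Continuous fun K : ℕ → Closeds I => K i := continuous_apply i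
  refine IsOpen.inter ?_ (isOpen_biInter_finset fun p _ => ?_)
  · exact (isOpen_closeds_subset (isOpen_biUnion fun _ _ => Metric.isOpen_ball)).preimage hc
  · exact (Closeds.isOpen_inter_nonempty_of_isOpen Metric.isOpen_ball).preimage hc

/-- A finite set as a closed set. -/
def ofFinset (F : Finset I) : Closeds I := ⟨F, F.finite_toSet.isClosed⟩

lemma ofFinset_mem_vietoris (N : ℕ) (F : ℕ → Finset I) {ρ : ℝ} (hρ : 0 < ρ) :
    (fun i => ofFinset (F i)) ∈ vietoris N F ρ := by
  refine fun i _ => ⟨fun x hx => ?_, fun p hp => ⟨p, hp, Metric.mem_ball_self hρ⟩⟩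
  exact Set.mem_biUnion (show x ∈ F i from hx) (Metric.mem_ball_self hρ)

lemma exists_finset_near (K : Closeds I) (B : Finset I) {ε : ℝ} (hε : 0 < ε) :
    ∃ F : Finset I, Disjoint F B ∧ (∀ x ∈ K, ∃ y ∈ F, dist x y ≤ ε) ∧
      ∀ y ∈ F, ∃ x ∈ K, dist y x ≤ ε := by
  classical
  obtain ⟨t, htK, htf, hcov⟩ := K.isClosed.isCompact.finite_cover_balls (half_pos hε)
  have hex (x : I) : ∃ y : I, y ∉ B ∧ dist x y < ε / 2 := by
    obtain ⟨y, hy, hxy⟩ := (dense_univ.sdiff_finset B).exists_dist_lt x (half_pos hε)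
    exact ⟨y, hy.2, hxy⟩
  choose φ hφB hφ using hex
  refine ⟨htf.toFinset.image φ, ?_, fun x hx => ?_, fun y hy => ?_⟩
  · rw [Finset.disjoint_left]
    intro y hy
    obtain ⟨x, -, rfl⟩ := Finset.mem_image.1 hy
    exact hφB x
  · obtain ⟨z, hz, hxz⟩ := Set.mem_iUnion₂.1 (hcov hx)
    refine ⟨φ z, Finset.mem_image_of_mem _ (htf.mem_toFinset.2 hz), ?_⟩
    linarith [dist_triangle x z (φ z), hφ z, Metric.mem_ball.1 hxz]
  · obtain ⟨x, hx, rfl⟩ := Finset.mem_image.1 hy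
    refine ⟨x, htK (htf.mem_toFinset.1 hx), ?_⟩
    rw [dist_comm]
    linarith [hφ x]

lemma exists_disjoint_finsets_near (K : ℕ → Closeds I) {ε : ℝ} (hε : 0 < ε) (N : ℕ) :
    ∃ F : ℕ → Finset I, (∀ i < N, ∀ j < N, i ≠ j → Disjoint (F i) (F j)) ∧
      ∀ i < N, (∀ x ∈ K i, ∃ y ∈ F i, dist x y ≤ ε) ∧ ∀ y ∈ F i, ∃ x ∈ K i, dist y x ≤ ε := by
  classical
  induction N with
  | zero => exact ⟨fun _ => ∅, by simp, by simp⟩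
  | succ N ih =>
    obtain ⟨F, hF, hFK⟩ := ih
    obtain ⟨G, hG, hGK⟩ := exists_finset_near (K N) ((Finset.range N).biUnion F) hε
    have hGd : ∀ i < N, Disjoint G (F i) := fun i hi =>
      (Finset.disjoint_biUnion_right _ _ _).1 hG i (Finset.mem_range.2 hi)
    refine ⟨Function.update F N G, fun i hi j hj hij => ?_, fun i hi => ?_⟩
    · rcases Nat.lt_succ_iff_lt_or_eq.1 hi with hi | rfl <;>
        rcases Nat.lt_succ_iff_lt_or_eq.1 hj with hj | rfl
      · rw [Function.update_of_ne hi.ne, Function.update_of_ne hj.ne]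
        exact hF i hi j hj hij
      · rw [Function.update_of_ne hi.ne, Function.update_self]
        exact (hGd i hi).symm
      · rw [Function.update_of_ne hj.ne, Function.update_self]
        exact hGd j hj
      · exact absurd rfl hij
    · rcases Nat.lt_succ_iff_lt_or_eq.1 hi with hi | rfl
      · rw [Function.update_of_ne hi.ne]
        exact hFK i hi
      · rw [Function.update_self]
        exact hGK

/-- Every nonempty open set of sequences contains a basic open set given by arbitrarily many
pairwise disjoint finite sets. -/
theorem exists_vietoris_subset {W : Set (ℕ → Closeds I)} (hW : IsOpen W) (hne : W.Nonempty)
    (N₀ : ℕ) : ∃ N ≥ N₀, ∃ F : ℕ → Finset I,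
      (∀ i < N, ∀ j < N, i ≠ j → Disjoint (F i) (F j)) ∧
      ∃ δ₀ > 0, ∀ δ ≤ δ₀, vietoris N F δ ⊆ W := by
  obtain ⟨K, hK⟩ := hne
  obtain ⟨J, u, hu, hJ⟩ := isOpen_pi_iff.1 hW K hK
  have hε : ∃ ε > (0 : ℝ), ∀ j ∈ J, Metric.eball (K j) (ENNReal.ofReal ε) ⊆ u j := by
    have h : ∀ᶠ ε in 𝓝[>] (0 : ℝ), ∀ j ∈ J, Metric.eball (K j) (ENNReal.ofReal ε) ⊆ u j := by
      rw [Filter.eventually_all_finset]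
      intro j hj
      obtain ⟨r, hr, hsub⟩ := EMetric.isOpen_iff.1 (hu j hj).1 _ (hu j hj).2
      have : Tendsto (fun ε : ℝ => ENNReal.ofReal ε) (𝓝[>] 0) (𝓝 0) := by
        have := (ENNReal.continuous_ofReal.tendsto 0).mono_left
          (nhdsWithin_le_nhds (s := Set.Ioi (0 : ℝ)))
        simpa using this
      filter_upwards [this.eventually (gt_mem_nhds hr)] with ε hε
      exact (Metric.eball_subset_eball hε.le).trans hsub
    obtain ⟨ε, h1, h2⟩ := (h.and self_mem_nhdsWithin).exists
    exact ⟨ε, h2, h1⟩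
  obtain ⟨ε, hε0, hε⟩ := hε
  obtain ⟨N₁, hN₁⟩ := J.exists_nat_subset_range
  obtain ⟨F, hF, hFK⟩ := exists_disjoint_finsets_near K (by positivity : 0 < ε / 4) (max N₀ N₁)
  refine ⟨max N₀ N₁, le_max_left _ _, F, hF, ε / 4, by positivity, fun δ hδ K' hK' => hJ ?_⟩
  intro j hj
  refine hε j hj ?_
  have hjN : j < max N₀ N₁ := (Finset.mem_range.1 (hN₁ hj)).trans_le (le_max_right _ _)
  obtain ⟨h1, h2⟩ := hK' j hjN
  obtain ⟨h3, h4⟩ := hFK j hjN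
  have : Metric.hausdorffEDist (K' j : Set I) (K j) ≤ ENNReal.ofReal (ε / 2) := by
    refine Metric.hausdorffEDist_le_of_mem_edist (fun x hx => ?_) (fun x hx => ?_)
    · obtain ⟨p, hp, hxp⟩ := Set.mem_iUnion₂.1 (h1 hx)
      obtain ⟨y, hy, hpy⟩ := h4 p hp
      refine ⟨y, hy, ?_⟩
      rw [edist_dist]
      refine ENNReal.ofReal_le_ofReal ?_
      linarith [dist_triangle x p y, Metric.mem_ball.1 hxp]
    · obtain ⟨p, hp, hxp⟩ := h3 x hx
      obtain ⟨y, hy, hyp⟩ := h2 p hp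
      refine ⟨y, hy, ?_⟩
      rw [edist_dist]
      refine ENNReal.ofReal_le_ofReal ?_
      linarith [dist_triangle_right x y p, Metric.mem_ball.1 hyp]
  exact this.trans_lt ((ENNReal.ofReal_lt_ofReal_iff hε0).2 (by linarith))

/-! ### A Banach–Mazur type argument -/

section BanachMazur

variable {X T : Type*} [TopologicalSpace X]

/-- The open set `O s` contains the pairwise disjoint open sets of a family of successors of `s`,
and their union is dense in `O s`. -/
lemma exists_disjoint_successors (O : T → Set X) (P : T → T → Prop) (s : T)
    (hs : IsOpen (O s))
    (H : ∀ W ⊆ O s, IsOpen W → W.Nonempty → ∃ s', P s s' ∧ IsOpen (O s') ∧ (O s').Nonempty ∧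
      O s' ⊆ W) :
    ∃ L : Set T, (∀ s' ∈ L, P s s' ∧ IsOpen (O s') ∧ O s' ⊆ O s) ∧
      (L.PairwiseDisjoint O) ∧ O s ⊆ closure (⋃ s' ∈ L, O s') := by
  let Q : T → Prop := fun s' => P s s' ∧ IsOpen (O s') ∧ O s' ⊆ O s ∧ (O s').Nonempty
  obtain ⟨L, hL⟩ := zorn_subset {L : Set T | (∀ s' ∈ L, Q s') ∧ L.PairwiseDisjoint O} (by
    intro c hc hchain
    refine ⟨⋃₀ c, ⟨fun s' ⟨l, hl, hs'⟩ => (hc hl).1 s' hs', ?_⟩,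
      fun l hl => Set.subset_sUnion_of_mem hl⟩
    exact (Set.pairwiseDisjoint_sUnion hchain.directedOn).2 fun l hl => (hc hl).2)
  refine ⟨L, fun s' hs' => ⟨(hL.prop.1 s' hs').1, (hL.prop.1 s' hs').2.1, (hL.prop.1 s' hs').2.2.1⟩,
    hL.prop.2, fun x hx => ?_⟩
  by_contra hcl
  obtain ⟨s', hP, hop, hne, hsub⟩ := H (O s ∩ (closure (⋃ s' ∈ L, O s'))ᶜ) Set.inter_subset_left
    (hs.inter isClosed_closure.isOpen_compl) ⟨x, hx, hcl⟩
  have hdis : ∀ l ∈ L, Disjoint (O s') (O l) := fun l hl => by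
    rw [Set.disjoint_left]
    exact fun y hy hyl => (hsub hy).2 (subset_closure (Set.mem_biUnion hl hyl))
  have hmem : s' ∈ L := by
    refine hL.le_of_ge (y := insert s' L) ⟨?_, ?_⟩ (Set.subset_insert _ _) (Set.mem_insert _ _)
    · rintro l (rfl | hl)
      · exact ⟨hP, hop, hsub.trans Set.inter_subset_left, hne⟩
      · exact hL.prop.1 l hl
    · exact hL.prop.2.insert fun l hl _ => hdis l hl
  exact hne.ne_empty (disjoint_self.1 (hdis _ hmem))

/-- If every nonempty open subset of the open set of a state contains the open set of a successor,
then residually many points lie in all the open sets of some chain of states. -/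
theorem residual_exists_chain (O : T → Set X) (P : ℕ → T → T → Prop) (s₀ : T)
    (h₀ : O s₀ = Set.univ)
    (H : ∀ t s, ∀ W ⊆ O s, IsOpen W → W.Nonempty →
      ∃ s', P t s s' ∧ IsOpen (O s') ∧ (O s').Nonempty ∧ O s' ⊆ W) :
    {x | ∃ ch : ℕ → T, ch 0 = s₀ ∧ ∀ t, P t (ch t) (ch (t + 1)) ∧ x ∈ O (ch t)} ∈ residual X := by
  have hex : ∀ t s, ∃ L : Set T, IsOpen (O s) → (∀ s' ∈ L, P t s s' ∧ IsOpen (O s') ∧ O s' ⊆ O s) ∧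
      (L.PairwiseDisjoint O) ∧ O s ⊆ closure (⋃ s' ∈ L, O s') := fun t s => by
    by_cases hs : IsOpen (O s)
    · obtain ⟨L, hL⟩ := exists_disjoint_successors O (P t) s hs (H t s)
      exact ⟨L, fun _ => hL⟩
    · exact ⟨∅, fun h => absurd h hs⟩
  choose succs hsuccs using hex
  let lev : ℕ → Set T := fun t => Nat.rec {s₀} (fun t L => ⋃ s ∈ L, succs t s) t
  have lev_succ (t) : lev (t + 1) = ⋃ s ∈ lev t, succs t s := rfl
  have hopen : ∀ t, ∀ s ∈ lev t, IsOpen (O s) := by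
    intro t
    induction t with
    | zero => intro s (hs : s = s₀); rw [hs, h₀]; exact isOpen_univ
    | succ t ih =>
      intro s hs
      rw [lev_succ] at hs
      obtain ⟨s', hs', hs⟩ := Set.mem_iUnion₂.1 hs
      exact ((hsuccs t s' (ih s' hs')).1 s hs).2.1
  have hdis : ∀ t, ∀ s ∈ lev t, ∀ s' ∈ lev t, ∀ x ∈ O s, x ∈ O s' → s = s' := by
    intro t
    induction t with
    | zero => intro s (hs : s = s₀) s' (hs' : s' = s₀) x _ _; rw [hs, hs']
    | succ t ih =>
      intro s hs s' hs' x hx hx'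
      rw [lev_succ] at hs hs'
      obtain ⟨q, hq, hs⟩ := Set.mem_iUnion₂.1 hs
      obtain ⟨q', hq', hs'⟩ := Set.mem_iUnion₂.1 hs'
      have h1 := hsuccs t q (hopen t q hq)
      have h2 := hsuccs t q' (hopen t q' hq')
      obtain rfl := ih q hq q' hq' x ((h1.1 s hs).2.2 hx) ((h2.1 s' hs').2.2 hx')
      exact h1.2.1.elim hs hs' (Set.not_disjoint_iff.2 ⟨x, hx, hx'⟩)
  let D : ℕ → Set X := fun t => ⋃ s ∈ lev t, O s
  have hDo (t) : IsOpen (D t) := isOpen_biUnion fun s hs => hopen t s hs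
  have hDd (t) : Dense (D t) := by
    induction t with
    | zero => simp [D, lev, h₀]
    | succ t ih =>
      have : D t ⊆ closure (D (t + 1)) := by
        refine Set.iUnion₂_subset fun s hs => (hsuccs t s (hopen t s hs)).2.2.trans ?_
        refine closure_mono (Set.iUnion₂_subset fun s' hs' => ?_)
        refine Set.subset_biUnion_of_mem (u := O) ?_
        rw [lev_succ]
        exact Set.mem_biUnion hs hs'
      exact dense_closure.1 (ih.mono this)
  have hD (t) : D t ∈ residual X := residual_of_dense_open (hDo t) (hDd t)
  refine mem_of_superset (countable_iInter_mem.2 hD) fun x hx => ?_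
  have hx' : ∀ t, ∃ s ∈ lev t, x ∈ O s := fun t => by
    obtain ⟨s, hs, h⟩ := Set.mem_iUnion₂.1 (Set.mem_iInter.1 hx t)
    exact ⟨s, hs, h⟩
  choose ch hch hxch using hx'
  refine ⟨ch, hch 0, fun t => ⟨?_, hxch t⟩⟩
  have := hch (t + 1)
  rw [lev_succ] at this
  obtain ⟨q, hq, hs⟩ := Set.mem_iUnion₂.1 this
  have h1 := (hsuccs t q (hopen t q hq)).1 _ hs
  have : q = ch t := hdis t q hq _ (hch t) x (h1.2.2 (hxch (t + 1))) (hxch t)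
  exact this ▸ h1.1

end BanachMazur

/-! ### Zigzag functions with spikes at the points of a grid -/

/-- The sign `(-1) ^ k`. -/
def sgn (k : ℕ) : ℝ := (-1) ^ k

lemma sgn_eq_or (k : ℕ) : sgn k = 1 ∨ sgn k = -1 := neg_one_pow_eq_or ℝ k

lemma sgn_succ (k : ℕ) : sgn (k + 1) = -sgn k := by simp [sgn, pow_succ]

lemma exists_sgn_eq {σ : ℝ} (hσ : σ = 1 ∨ σ = -1) {a : ℝ} (ha : 0 ≤ a) :
    ∃ l : ℕ, sgn l = σ ∧ a < l ∧ (l : ℝ) ≤ a + 2 := by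
  have h1 := Nat.floor_le ha
  have h2 := Nat.lt_floor_add_one a
  have key : sgn (⌊a⌋₊ + 1) = σ ∨ sgn (⌊a⌋₊ + 1 + 1) = σ := by
    rw [sgn_succ (⌊a⌋₊ + 1)]
    rcases sgn_eq_or (⌊a⌋₊ + 1) with h | h <;> rcases hσ with rfl | rfl <;> rw [h] <;> simp
  rcases key with h | h
  · exact ⟨_, h, by push_cast; linarith, by push_cast; linarith⟩
  · exact ⟨_, h, by push_cast; linarith, by push_cast; linarith⟩

/-- Data for a family of functions close to `g` off small balls around the points `k / R`, with a
spike of height about `A` and sign `(-1) ^ k` in the ball of radius `r` around `k / R`. -/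
structure Frame where
  g : C(I, ℝ)
  R : ℕ
  A : ℝ
  ω : ℝ
  r : ℝ
  R_pos : 0 < R
  A_pos : 0 < A
  ω_pos : 0 < ω
  r_pos : 0 < r
  ω_le : ω ≤ A / 16
  r_le : r ≤ 1 / (32 * R)
  osc : ∀ x y : I, dist x y ≤ 3 / R → |g x - g y| ≤ A / 8

namespace Frame

variable (D : Frame)

/-- The grid point `k / R`. -/
noncomputable def pt (k : ℕ) : I := Set.projIcc 0 1 zero_le_one ((k : ℝ) / D.R)

/-- The functions that are close to `g` off the balls and have the required spikes. -/
def nbhd : Set C(I, ℝ) :=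
  {f | (∀ x, (∀ k ≤ D.R, D.r ≤ dist x (D.pt k)) → |f x - D.g x| ≤ D.ω) ∧
    ∀ k ≤ D.R, (∀ x, dist x (D.pt k) ≤ D.r → sgn k * D.g x - D.ω ≤ sgn k * f x ∧
        sgn k * f x ≤ sgn k * D.g (D.pt k) + D.A + D.ω) ∧
      ∃ x, dist x (D.pt k) ≤ D.r ∧ sgn k * D.g (D.pt k) + D.A - D.ω ≤ sgn k * f x}

lemma R_pos' : (0 : ℝ) < D.R := Nat.cast_pos.2 D.R_pos

lemma coe_pt {k : ℕ} (hk : k ≤ D.R) : (D.pt k : ℝ) = k / D.R := by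
  have h : (k : ℝ) / D.R ∈ Set.Icc (0 : ℝ) 1 :=
    ⟨by positivity, div_le_one_of_le₀ (by exact_mod_cast hk) (Nat.cast_nonneg _)⟩
  rw [pt, Set.projIcc_of_mem _ h]

lemma r_le' : D.r ≤ 1 / D.R / 32 := by
  have := D.r_le
  rw [div_div, mul_comm]; exact this

lemma le_dist_pt {k l : ℕ} (hk : k ≤ D.R) (hl : l ≤ D.R) (hkl : k ≠ l) :
    1 / D.R ≤ dist (D.pt k) (D.pt l) := by
  rw [Subtype.dist_eq, Real.dist_eq, D.coe_pt hk, D.coe_pt hl, ← sub_div, abs_div,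
    abs_of_pos D.R_pos']
  refine div_le_div_of_nonneg_right ?_ D.R_pos'.le
  have h : (1 : ℤ) ≤ |(k : ℤ) - l| := Int.one_le_abs (by omega)
  exact_mod_cast h

lemma eq_of_dist_le {k l : ℕ} (hk : k ≤ D.R) (hl : l ≤ D.R) {x : I}
    (h1 : dist x (D.pt k) ≤ 1 / D.R / 2) (h2 : dist x (D.pt l) ≤ D.r) : k = l := by
  by_contra hne
  have := D.le_dist_pt hk hl hne
  have := dist_triangle_left (D.pt k) (D.pt l) x
  have := D.r_le'
  have : 0 < 1 / (D.R : ℝ) := one_div_pos.2 D.R_pos'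
  linarith

/-- A function of `D.nbhd` has no one-sided bound of sign `σ` at a point where it is not
higher (in direction `σ`) than `g`. -/
theorem notMem_boundedAt {f : C(I, ℝ)} (hf : f ∈ D.nbhd) {σ d c : ℝ} (hσ : σ = 1 ∨ σ = -1)
    (hd : d = 1 ∨ d = -1) (hc : 0 < c) (hcR : 3 * c / D.R < 1) (hcA : 3 * c / D.R ≤ D.A / 8)
    {x : I} (hx : σ * f x ≤ σ * D.g x + D.ω) : x ∉ boundedAt σ d c f := by
  rintro ⟨hxc, hb⟩
  have hR := D.R_pos'
  have hwin : 3 / D.R < 1 / c := by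
    rw [div_lt_div_iff₀ hR hc]
    rw [div_lt_one hR] at hcR
    linarith
  have hrR : D.r * D.R ≤ 1 / 32 := by
    have := D.r_le'
    rw [div_div, le_div_iff₀ (by positivity)] at this
    linarith
  have hr0 : 0 ≤ D.r * D.R := mul_nonneg D.r_pos.le hR.le
  have hx0 := x.2.1
  have hx1 := x.2.2
  -- a spike of sign `σ` in the window
  obtain ⟨l, hl, hlσ, hl1, hl2⟩ : ∃ l ≤ D.R, sgn l = σ ∧ D.r * D.R < d * (l - x * D.R) ∧
      d * (l - x * D.R) ≤ 11 / 4 := by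
    rcases hd with rfl | rfl
    · obtain ⟨l, hlσ, h1, h2⟩ := exists_sgn_eq hσ (a := x * D.R + D.r * D.R) (by positivity)
      refine ⟨l, ?_, hlσ, by linarith, by linarith⟩
      have : (x : ℝ) + 3 / D.R < 1 := by linarith [hxc.2]
      have : ((x : ℝ) + 3 / D.R) * D.R < 1 * D.R := mul_lt_mul_of_pos_right this hR
      rw [add_mul, div_mul_cancel₀ _ hR.ne'] at this
      have : (l : ℝ) ≤ D.R := by linarith
      exact_mod_cast this
    · have hxc1 := hxc.1
      rw [neg_div] at hxc1
      have : 3 / D.R < (x : ℝ) := by linarith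
      rw [div_lt_iff₀ hR] at this
      obtain ⟨l, hlσ, h1, h2⟩ := exists_sgn_eq hσ (a := x * D.R - D.r * D.R - 5 / 2)
        (by linarith)
      refine ⟨l, ?_, hlσ, by linarith, by linarith⟩
      have : (l : ℝ) ≤ D.R := by nlinarith
      exact_mod_cast this
  obtain ⟨y, hy, hyf⟩ := (hf.2 l hl).2
  have hpt := D.coe_pt hl
  have e1 : d * ((D.pt l : ℝ) - x) = d * (l - x * D.R) / D.R := by
    rw [hpt]; field_simp
  have h1 : D.r < d * ((D.pt l : ℝ) - x) := by
    rw [e1, lt_div_iff₀ hR]; exact hl1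
  have h2 : d * ((D.pt l : ℝ) - x) ≤ (11 / 4) / D.R := by
    rw [e1]; exact div_le_div_of_nonneg_right hl2 hR.le
  have hyl : |(y : ℝ) - D.pt l| ≤ D.r := hy
  have hdy : |d * ((y : ℝ) - D.pt l)| ≤ D.r := by
    rw [abs_mul]
    rcases hd with rfl | rfl <;> simpa only [abs_neg, abs_one, one_mul] using hyl
  have e2 : d * ((y : ℝ) - x) = d * ((y : ℝ) - D.pt l) + d * ((D.pt l : ℝ) - x) := by ring
  have hr := D.r_le'
  have hpos : 0 < 1 / (D.R : ℝ) := one_div_pos.2 hR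
  have e3 : (11 / 4) / (D.R : ℝ) = 11 / 4 * (1 / D.R) := by ring
  have e4 : 3 / (D.R : ℝ) = 3 * (1 / D.R) := by ring
  have h3 : 0 < d * ((y : ℝ) - x) := by linarith [(abs_le.1 hdy).1]
  have h4 : d * ((y : ℝ) - x) ≤ 3 / D.R := by
    rw [e3] at h2; rw [e4]
    linarith [(abs_le.1 hdy).2]
  have h5 := hb y h3 (h4.trans_lt hwin)
  have h6 : dist (D.pt l) x ≤ 3 / D.R := by
    rw [Subtype.dist_eq, Real.dist_eq]
    have : |(D.pt l : ℝ) - x| = d * ((D.pt l : ℝ) - x) := by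
      have h0 := D.r_pos.trans h1
      rcases hd with rfl | rfl
      · rw [one_mul] at h0 ⊢; exact abs_of_pos h0
      · rw [abs_of_neg (by linarith)]; ring
    rw [this, e4]; rw [e3] at h2
    linarith
  have h7 : σ * D.g x - σ * D.g (D.pt l) ≤ D.A / 8 := by
    have := abs_le.1 (D.osc _ _ h6)
    rcases hσ with rfl | rfl <;> linarith [this.1, this.2]
  have h8 : c * (d * ((y : ℝ) - x)) ≤ D.A / 8 := by
    refine le_trans ?_ hcA
    have := mul_le_mul_of_nonneg_left h4 hc.le
    calc _ ≤ c * (3 / D.R) := this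
      _ = _ := by ring
  rw [hlσ] at hyf
  have := D.ω_le
  have := D.A_pos
  linarith

lemma notMem_boundedSet {f : C(I, ℝ)} (hf : f ∈ D.nbhd) {c : ℝ} (hc : 0 < c)
    (hcR : 3 * c / D.R < 1) (hcA : 3 * c / D.R ≤ D.A / 8) {x : I}
    (hx : |f x - D.g x| ≤ D.ω) : x ∉ boundedSet c f := by
  rintro ⟨σ, d, hσ, hd, h⟩
  refine D.notMem_boundedAt hf hσ hd hc hcR hcA ?_ h
  have := abs_le.1 hx
  rcases hσ with rfl | rfl <;> linarith [this.1, this.2]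

lemma exists_dist_pt_lt {f : C(I, ℝ)} (hf : f ∈ D.nbhd) {c : ℝ} (hc : 0 < c)
    (hcR : 3 * c / D.R < 1) (hcA : 3 * c / D.R ≤ D.A / 8) {x : I} (hx : x ∈ boundedSet c f) :
    ∃ k ≤ D.R, dist x (D.pt k) < D.r := by
  by_contra! h
  exact D.notMem_boundedSet hf hc hcR hcA (hf.1 x h) hx

lemma eq_sgn_of_mem_boundedAt {f : C(I, ℝ)} (hf : f ∈ D.nbhd) {σ d c : ℝ} (hσ : σ = 1 ∨ σ = -1)
    (hd : d = 1 ∨ d = -1) (hc : 0 < c) (hcR : 3 * c / D.R < 1) (hcA : 3 * c / D.R ≤ D.A / 8)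
    {x : I} {k : ℕ} (hk : k ≤ D.R) (hxk : dist x (D.pt k) ≤ D.r) (hx : x ∈ boundedAt σ d c f) :
    σ = sgn k := by
  by_contra hne
  have hσ' : σ = -sgn k := by
    rcases sgn_eq_or k with h | h <;> rcases hσ with rfl | rfl <;> simp_all
  refine D.notMem_boundedAt hf hσ hd hc hcR hcA ?_ hx
  have := ((hf.2 k hk).1 x hxk).1
  rw [hσ']
  linarith

/-- Off the ball around `k / R`, but within half the grid size, functions of `D.nbhd` stay well
below the top of the spike. -/
lemma le_of_dist_le {f : C(I, ℝ)} (hf : f ∈ D.nbhd) {k : ℕ} (hk : k ≤ D.R) {y : I}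
    (hy : D.r < dist y (D.pt k)) (hy' : dist y (D.pt k) ≤ 1 / D.R / 2) :
    sgn k * f y ≤ sgn k * D.g (D.pt k) + D.A / 8 + D.ω := by
  have hoff : ∀ l ≤ D.R, D.r ≤ dist y (D.pt l) := fun l hl => by
    by_contra! hlt
    obtain rfl := D.eq_of_dist_le hk hl hy' hlt.le
    linarith
  have h1 := abs_le.1 (hf.1 y hoff)
  have hpos : 0 < 1 / (D.R : ℝ) := one_div_pos.2 D.R_pos'
  have e : 3 / (D.R : ℝ) = 3 * (1 / D.R) := by ring
  have h2 := abs_le.1 (D.osc y (D.pt k) (by rw [e]; linarith))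
  rcases sgn_eq_or k with h | h <;> rw [h] <;> linarith [h1.1, h1.2, h2.1, h2.2]

/-- Two functions of `D.nbhd` are close to each other up to a small shift of the argument. -/
theorem exists_near_le {f f₀ : C(I, ℝ)} (hf : f ∈ D.nbhd) (hf₀ : f₀ ∈ D.nbhd) {κ : ℝ} (hκ : 0 ≤ κ)
    (hosc : ∀ x y : I, dist x y ≤ 2 * D.r → |D.g x - D.g y| ≤ κ) {σ : ℝ} (hσ : σ = 1 ∨ σ = -1)
    (y : I) : ∃ z : I, dist z y ≤ 2 * D.r ∧ σ * f y ≤ σ * f₀ z + 2 * D.ω + κ := by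
  have hr := D.r_pos
  have hR := D.R_pos'
  have hpos : 0 < 1 / (D.R : ℝ) := one_div_pos.2 hR
  have hrle := D.r_le'
  by_cases hoff : ∀ l ≤ D.R, D.r ≤ dist y (D.pt l)
  · refine ⟨y, by simp [hr.le], ?_⟩
    have h1 := abs_le.1 (hf.1 y hoff)
    have h2 := abs_le.1 (hf₀.1 y hoff)
    rcases hσ with rfl | rfl <;> linarith [h1.1, h1.2, h2.1, h2.2]
  push Not at hoff
  obtain ⟨l, hl, hyl⟩ := hoff
  by_cases hs : sgn l = σ
  · obtain ⟨z, hz, hzf⟩ := (hf₀.2 l hl).2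
    refine ⟨z, (dist_triangle_right z y (D.pt l)).trans (by linarith), ?_⟩
    have := ((hf.2 l hl).1 y hyl.le).2
    rw [hs] at this hzf
    linarith
  · have hσ' : σ = -sgn l := by
      rcases sgn_eq_or l with h | h <;> rcases hσ with rfl | rfl <;> simp_all
    -- a point on the boundary of the ball
    obtain ⟨z, hz⟩ : ∃ z : I, dist z (D.pt l) = D.r := by
      have hpl := D.coe_pt hl
      have h1R : 1 / (D.R : ℝ) ≤ 1 := by
        rw [div_le_one hR]; exact_mod_cast D.R_pos
      rcases le_or_gt ((D.pt l : ℝ)) (1 / 2) with h | h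
      · refine ⟨⟨D.pt l + D.r, by linarith [(D.pt l).2.1], by linarith⟩, ?_⟩
        rw [Subtype.dist_eq, Real.dist_eq]
        simp [abs_of_pos hr]
      · refine ⟨⟨D.pt l - D.r, by linarith, by linarith [(D.pt l).2.2]⟩, ?_⟩
        rw [Subtype.dist_eq, Real.dist_eq]
        simp [abs_of_pos hr]
    have hzy : dist z y ≤ 2 * D.r := (dist_triangle_right z y (D.pt l)).trans (by linarith)
    refine ⟨z, hzy, ?_⟩
    have hzoff : ∀ j ≤ D.R, D.r ≤ dist z (D.pt j) := fun j hj => by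
      by_contra! hlt
      obtain rfl := D.eq_of_dist_le hl hj (by linarith) hlt.le
      linarith
    have h1 := ((hf.2 l hl).1 y hyl.le).1
    have h2 := abs_le.1 (hf₀.1 z hzoff)
    have h3 := abs_le.1 (hosc z y hzy)
    rw [hσ']
    rcases sgn_eq_or l with h | h <;> rw [h] at h1 ⊢ <;> linarith [h2.1, h2.2, h3.1, h3.2]

/-- There is a function of `D.nbhd` whose spikes have their tops at prescribed finite sets of
points, and which is equal to `g` at distance at least `δ` from these points. -/
theorem exists_spikes (G : ℕ → Finset I) {δ : ℝ} (hδ : 0 < δ)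
    (hne : ∀ k ≤ D.R, (G k).Nonempty) (hG : ∀ k ≤ D.R, ∀ p ∈ G k, dist p (D.pt k) + δ ≤ D.r) :
    ∃ f : C(I, ℝ), (∀ k ≤ D.R, ∀ p ∈ G k, sgn k * f p = sgn k * D.g (D.pt k) + D.A) ∧
      (∀ x, (∀ k ≤ D.R, ∀ p ∈ G k, δ ≤ dist x p) → f x = D.g x) ∧
      (∀ k ≤ D.R, ∀ x, dist x (D.pt k) ≤ D.r → sgn k * D.g x ≤ sgn k * f x ∧
        sgn k * f x ≤ sgn k * D.g (D.pt k) + D.A) := by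
  have hR := D.R_pos'
  have hpos : 0 < 1 / (D.R : ℝ) := one_div_pos.2 hR
  have hrle := D.r_le'
  let φ : ℕ → I → ℝ := fun k x => max 0 (1 - Metric.infDist x (G k : Set I) / δ)
  have hφc (k : ℕ) : Continuous (φ k) := by
    have := Metric.continuous_infDist_pt (G k : Set I)
    fun_prop
  have hφ0 (k x) : 0 ≤ φ k x := le_max_left _ _
  have hφ1 (k x) : φ k x ≤ 1 := by
    refine max_le zero_le_one ?_
    have : 0 ≤ Metric.infDist x (G k : Set I) / δ := div_nonneg Metric.infDist_nonneg hδ.le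
    linarith
  have hφoff {k} (hk : k ≤ D.R) {x : I} (h : ∀ p ∈ G k, δ ≤ dist x p) : φ k x = 0 := by
    refine max_eq_left ?_
    have : δ ≤ Metric.infDist x (G k : Set I) :=
      (Metric.le_infDist (Finset.coe_nonempty.2 (hne k hk))).2 fun {p} hp => h p hp
    have := (one_le_div hδ).2 this
    linarith
  have hφfar {k l} (hk : k ≤ D.R) (hl : l ≤ D.R) (hkl : l ≠ k) {x : I}
      (hx : dist x (D.pt k) ≤ D.r) : φ l x = 0 := by
    refine hφoff hl fun p hp => ?_
    by_contra! hlt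
    have h1 := hG l hl p hp
    exact hkl (D.eq_of_dist_le hl hk (by linarith [dist_triangle x p (D.pt l)]) hx)
  let f : C(I, ℝ) := ⟨fun x => D.g x + ∑ k ∈ Finset.range (D.R + 1),
    φ k x * (D.g (D.pt k) + sgn k * D.A - D.g x), by fun_prop⟩
  have hfx (x : I) : f x = D.g x + ∑ k ∈ Finset.range (D.R + 1),
    φ k x * (D.g (D.pt k) + sgn k * D.A - D.g x) := rfl
  have hfk {k} (hk : k ≤ D.R) {x : I} (hx : dist x (D.pt k) ≤ D.r) :
      f x = D.g x + φ k x * (D.g (D.pt k) + sgn k * D.A - D.g x) := by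
    rw [hfx, Finset.sum_eq_single k]
    · intro l hl hlk
      rw [hφfar hk (Nat.lt_succ_iff.1 (Finset.mem_range.1 hl)) hlk hx, zero_mul]
    · intro h
      exact absurd (Finset.mem_range.2 (Nat.lt_succ_of_le hk)) h
  refine ⟨f, fun k hk p hp => ?_, fun x hx => ?_, fun k hk x hx => ?_⟩
  · have hpk := hG k hk p hp
    have hφp : φ k p = 1 := by
      simp only [φ]
      rw [Metric.infDist_zero_of_mem (Finset.mem_coe.2 hp)]; simp
    rw [hfk hk (by linarith), hφp]
    rcases sgn_eq_or k with h | h <;> rw [h] <;> ring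
  · rw [hfx, Finset.sum_eq_zero, add_zero]
    intro k hk
    have hk := Nat.lt_succ_iff.1 (Finset.mem_range.1 hk)
    rw [hφoff hk (hx k hk), zero_mul]
  · have e : 3 / (D.R : ℝ) = 3 * (1 / D.R) := by ring
    have h2 := abs_le.1 (D.osc x (D.pt k) (by rw [e]; linarith))
    have h0 : 0 ≤ sgn k * D.g (D.pt k) + D.A - sgn k * D.g x := by
      have := D.A_pos
      rcases sgn_eq_or k with h | h <;> rw [h] <;> linarith [h2.1, h2.2]
    have e2 : sgn k * f x = sgn k * D.g x +
        φ k x * (sgn k * D.g (D.pt k) + D.A - sgn k * D.g x) := by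
      rw [hfk hk hx]
      rcases sgn_eq_or k with h | h <;> rw [h] <;> ring
    rw [e2]
    have h3 := mul_nonneg (hφ0 k x) h0
    have h4 := mul_le_mul_of_nonneg_right (hφ1 k x) h0
    exact ⟨by linarith, by linarith⟩

/-- Functions close to one with exact spikes belong to `D.nbhd`. -/
lemma mem_nbhd_of_near {G : ℕ → Finset I} {δ : ℝ} (hδ : 0 < δ)
    (hne : ∀ k ≤ D.R, (G k).Nonempty) (hG : ∀ k ≤ D.R, ∀ p ∈ G k, dist p (D.pt k) + δ ≤ D.r)
    {f f' : C(I, ℝ)}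
    (h1 : ∀ k ≤ D.R, ∀ p ∈ G k, sgn k * f p = sgn k * D.g (D.pt k) + D.A)
    (h2 : ∀ x, (∀ k ≤ D.R, ∀ p ∈ G k, δ ≤ dist x p) → f x = D.g x)
    (h3 : ∀ k ≤ D.R, ∀ x, dist x (D.pt k) ≤ D.r → sgn k * D.g x ≤ sgn k * f x ∧
        sgn k * f x ≤ sgn k * D.g (D.pt k) + D.A)
    (hf' : ∀ x, |f' x - f x| ≤ D.ω) : f' ∈ D.nbhd := by
  have hs (k x) : |sgn k * f' x - sgn k * f x| ≤ D.ω := by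
    rw [← mul_sub, abs_mul]
    rcases sgn_eq_or k with h | h <;> simpa [h] using hf' x
  refine ⟨fun x hx => ?_, fun k hk => ⟨fun x hx => ?_, ?_⟩⟩
  · rw [← h2 x fun k hk p hp => ?_]
    · exact hf' x
    · have := hx k hk
      have := hG k hk p hp
      linarith [dist_triangle x p (D.pt k)]
  · have a := abs_le.1 (hs k x)
    have b := h3 k hk x hx
    exact ⟨by linarith [a.1, b.1], by linarith [a.2, b.2]⟩
  · obtain ⟨p, hp⟩ := hne k hk
    have := hG k hk p hp
    refine ⟨p, by linarith, ?_⟩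
    have a := abs_le.1 (hs k p)
    linarith [a.1, h1 k hk p hp]

lemma nbhd_nonempty : D.nbhd.Nonempty := by
  have hne : ∀ k ≤ D.R, ({D.pt k} : Finset I).Nonempty := fun _ _ => Finset.singleton_nonempty _
  have hG : ∀ k ≤ D.R, ∀ p ∈ ({D.pt k} : Finset I), dist p (D.pt k) + D.r ≤ D.r := by
    intro k _ p hp
    rw [Finset.mem_singleton.1 hp, dist_self, zero_add]
  obtain ⟨f, h1, h2, h3⟩ := D.exists_spikes (fun k => {D.pt k}) D.r_pos hne hG
  exact ⟨f, D.mem_nbhd_of_near D.r_pos hne hG h1 h2 h3 fun x => by simpa using D.ω_pos.le⟩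

lemma dist_le_of_mem_nbhd {f : C(I, ℝ)} (hf : f ∈ D.nbhd) : dist f D.g ≤ 2 * D.A := by
  have hA := D.A_pos
  have hω := D.ω_le
  refine (ContinuousMap.dist_le (by linarith)).2 fun x => ?_
  rw [Real.dist_eq]
  by_cases hoff : ∀ l ≤ D.R, D.r ≤ dist x (D.pt l)
  · exact (hf.1 x hoff).trans (by linarith)
  push Not at hoff
  obtain ⟨l, hl, hxl⟩ := hoff
  have hpos : 0 < 1 / (D.R : ℝ) := one_div_pos.2 D.R_pos'
  have e : 3 / (D.R : ℝ) = 3 * (1 / D.R) := by ring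
  have h2 := abs_le.1 (D.osc x (D.pt l) (by rw [e]; linarith [D.r_le']))
  have h1 := (hf.2 l hl).1 x hxl.le
  rw [abs_le]
  rcases sgn_eq_or l with h | h <;> rw [h] at h1 <;>
    exact ⟨by linarith [h1.1, h1.2, h2.1, h2.2], by linarith [h1.1, h1.2, h2.1, h2.2]⟩

end Frame
/-! ### The two kinds of positions -/

/-- An open set `U` of functions together with finite sets `F i`, `i < N`, such that near every
point of `F i` every function of `U` has a point with a one-sided bound about `e i`. -/
structure Pinned where
  N : ℕ
  F : ℕ → Finset I
  δ : ℝ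
  e : ℕ → ℝ
  θ : ℝ
  U : Set C(I, ℝ)
  δ_pos : 0 < δ
  θ_nonneg : 0 ≤ θ
  θ_lt : θ < 1
  one_le_e : ∀ i < N, 1 ≤ e i
  le_e : ∀ i < N, (i : ℝ) ≤ e i
  isOpen_U : IsOpen U
  U_nonempty : U.Nonempty
  sep : ∀ i < N, ∀ j < N, i ≠ j → ∀ p ∈ F i, ∀ q ∈ F j, 4 * δ < dist p q
  forced : ∀ i < N, ∀ p ∈ F i, ∀ f ∈ U, ∃ x ∈ boundedSet (e i + θ) f, dist x p ≤ δ

/-- The open set of sequences of closed sets attached to a pinned position. -/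
def Pinned.V (b : Pinned) : Set (ℕ → Closeds I) := vietoris b.N b.F (2 * b.δ)

/-- Replace the open set of functions by a smaller one. -/
def Pinned.restrict (b : Pinned) (W : Set C(I, ℝ)) (hW : IsOpen W) (hne : W.Nonempty)
    (hsub : W ⊆ b.U) : Pinned :=
  { b with
    U := W
    isOpen_U := hW
    U_nonempty := hne
    forced := fun i hi p hp f hf => b.forced i hi p hp f (hsub hf) }

/-- A family of functions with spikes, together with a labelling of the spikes by numbers `< N`
(other labels are irrelevant), such that every function of the family stays, on one side of a
labelled spike, below the lines through the top of the spike with slope given by the label. -/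
structure Loose extends Frame where
  N : ℕ
  ℓ : ℕ → ℕ
  e : ℕ → ℝ
  θ : ℝ
  μ : ℝ
  θ_nonneg : 0 ≤ θ
  θ_lt : θ < 1
  μ_pos : 0 < μ
  one_le_e : ∀ i < N, 1 ≤ e i
  le_e : ∀ i < N, (i : ℝ) ≤ e i
  N_lt : 3 * (N : ℝ) / R < 1
  N_le : 3 * (N : ℝ) / R ≤ A / 8
  forced : ∀ k ≤ R, ℓ k < N → ∃ d : ℝ, (d = 1 ∨ d = -1) ∧
    (∀ p : I, dist p (toFrame.pt k) ≤ r → (p : ℝ) + d / (e (ℓ k) + θ) ∈ Set.Icc (0 : ℝ) 1) ∧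
    ∀ f ∈ toFrame.nbhd, ∀ p y : I, dist p (toFrame.pt k) ≤ r → r < dist y (toFrame.pt k) →
      0 ≤ d * ((y : ℝ) - p) → d * ((y : ℝ) - p) ≤ 1 / (e (ℓ k) + θ) →
      sgn k * f y ≤ sgn k * g (toFrame.pt k) + A + (e (ℓ k) + θ) * (d * ((y : ℝ) - p)) - μ

/-- The centers of the spikes with label `i`. -/
noncomputable def Loose.centers (c : Loose) (i : ℕ) : Finset I :=
  open Classical in ((Finset.range (c.R + 1)).filter fun k => c.ℓ k = i).image c.pt

lemma Loose.mem_centers {c : Loose} {i : ℕ} {x : I} :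
    x ∈ c.centers i ↔ ∃ k ≤ c.R, c.ℓ k = i ∧ c.pt k = x := by
  simp [centers, and_assoc]

/-- The open set of sequences of closed sets attached to a loose position. -/
def Loose.V (c : Loose) : Set (ℕ → Closeds I) := vietoris c.N c.centers c.r

/-- The relation "the pinned position `b` refines the loose position `c`". -/
structure RefinesLoose (c : Loose) (b : Pinned) : Prop where
  U_subset : b.U ⊆ c.nbhd
  V_subset : b.V ⊆ c.V
  N_le : c.N ≤ b.N
  e_eq : ∀ i < c.N, b.e i = c.e i
  δ_le : b.δ ≤ 1 / (b.N + 1)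
  near : ∀ f ∈ b.U, ∀ k ≤ c.R, c.ℓ k < c.N → ∀ x, dist x (c.pt k) ≤ c.r →
    ∀ m : ℕ, m + 1 ≤ c.N → x ∈ boundedSet (m + 1) f → ∃ p ∈ b.F (c.ℓ k), dist x p ≤ b.δ

/-- The relation "the loose position `c` refines the pinned position `b`". -/
structure RefinesPinned (b : Pinned) (c : Loose) : Prop where
  U_subset : c.nbhd ⊆ b.U
  V_subset : c.V ⊆ b.V
  N_eq : c.N = b.N + 1
  e_eq : ∀ i < b.N, c.e i = b.e i
  r_le : c.r ≤ 1 / (c.N + 1)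
  exists_label : ∀ f ∈ c.nbhd, ∀ m : ℕ, m + 1 ≤ c.N → ∀ x ∈ boundedSet (m + 1) f,
    ∃ k ≤ c.R, c.ℓ k < c.N ∧ dist x (c.pt k) ≤ c.r
  near : ∀ f ∈ c.nbhd, ∀ i < b.N, ∀ m : ℕ, (m : ℝ) + 1 ≤ b.e i →
    ∀ x ∈ boundedSet (m + 1) f, ∀ p ∈ b.F i, dist x p ≤ b.δ →
      ∃ k ≤ c.R, c.ℓ k = i ∧ dist x (c.pt k) ≤ c.r

lemma Loose.notMem_boundedSet (c : Loose) {f : C(I, ℝ)} (hf : f ∈ c.nbhd) {m : ℕ}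
    (hm : m + 1 ≤ c.N) {x : I} (hx : |f x - c.g x| ≤ c.ω) : x ∉ boundedSet (m + 1) f := by
  have hR := c.R_pos'
  have hle : 3 * ((m : ℝ) + 1) / c.R ≤ 3 * (c.N : ℝ) / c.R := by
    have : (m : ℝ) + 1 ≤ c.N := by exact_mod_cast hm
    gcongr
  exact c.toFrame.notMem_boundedSet hf (by positivity) (hle.trans_lt c.N_lt) (hle.trans c.N_le) hx

/-- Every nonempty open subset of `c.V` contains the open set of a pinned position refining `c`. -/
theorem Loose.exists_refinesLoose (c : Loose) {W : Set (ℕ → Closeds I)} (hW : IsOpen W)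
    (hne : W.Nonempty) (hWc : W ⊆ c.V) :
    ∃ b : Pinned, RefinesLoose c b ∧ b.V ⊆ W := by
  classical
  obtain ⟨N, hN, F, hFdis, δ₀, hδ₀, hFW⟩ := exists_vietoris_subset hW hne c.N
  have hFV : (fun i => ofFinset (F i)) ∈ c.V := hWc (hFW δ₀ le_rfl (ofFinset_mem_vietoris N F hδ₀))
  let G : ℕ → Finset I := fun k =>
    if c.ℓ k < c.N then (F (c.ℓ k)).filter fun p => dist p (c.pt k) < c.r else {c.pt k}
  have hGlab {k} (h : c.ℓ k < c.N) : G k = (F (c.ℓ k)).filter fun p => dist p (c.pt k) < c.r :=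
    if_pos h
  have hGne : ∀ k ≤ c.R, (G k).Nonempty := by
    intro k hk
    by_cases h : c.ℓ k < c.N
    · obtain ⟨p, hpF, hp⟩ := (hFV _ h).2 (c.pt k) (Loose.mem_centers.2 ⟨k, hk, rfl, rfl⟩)
      rw [hGlab h]
      exact ⟨p, Finset.mem_filter.2 ⟨hpF, hp⟩⟩
    · simp [G, h]
  have hGr : ∀ k ≤ c.R, ∀ p ∈ G k, dist p (c.pt k) < c.r := by
    intro k hk p hp
    by_cases h : c.ℓ k < c.N
    · rw [hGlab h] at hp
      exact (Finset.mem_filter.1 hp).2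
    · simp only [G, h, if_false, Finset.mem_singleton] at hp
      rw [hp, dist_self]; exact c.r_pos
  set θ' : ℝ := (c.θ + 1) / 2 with hθ'
  have hθ := c.θ_nonneg
  have hθ1 := c.θ_lt
  -- choice of `δ`
  obtain ⟨δ, hδ, hδδ₀, hδN, hδ4, hδG, hδsep, hδe⟩ : ∃ δ > (0 : ℝ), 2 * δ ≤ δ₀ ∧ δ ≤ 1 / (N + 1) ∧
      δ ≤ 1 / 4 ∧ (∀ k ∈ Finset.range (c.R + 1), ∀ p ∈ G k, dist p (c.pt k) + δ ≤ c.r) ∧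
      (∀ i ∈ Finset.range N, ∀ j ∈ Finset.range N, ∀ p ∈ F i, ∀ q ∈ F j, i ≠ j →
        4 * δ < dist p q) ∧
      (∀ i ∈ Finset.range c.N, 1 / (c.e i + θ') + δ ≤ 1 / (c.e i + c.θ)) := by
    have hsmall {a : ℝ} (ha : 0 < a) : ∀ᶠ δ in 𝓝[>] (0 : ℝ), δ ≤ a :=
      eventually_nhdsWithin_of_eventually_nhds (eventually_le_nhds ha)
    have h : ∀ᶠ δ in 𝓝[>] (0 : ℝ), 0 < δ ∧ 2 * δ ≤ δ₀ ∧ δ ≤ 1 / (N + 1) ∧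
      δ ≤ 1 / 4 ∧ (∀ k ∈ Finset.range (c.R + 1), ∀ p ∈ G k, dist p (c.pt k) + δ ≤ c.r) ∧
      (∀ i ∈ Finset.range N, ∀ j ∈ Finset.range N, ∀ p ∈ F i, ∀ q ∈ F j, i ≠ j →
        4 * δ < dist p q) ∧
      (∀ i ∈ Finset.range c.N, 1 / (c.e i + θ') + δ ≤ 1 / (c.e i + c.θ)) := by
      refine eventually_mem_nhdsWithin.and (.and ?_ (.and ?_ (.and ?_ (.and ?_ (.and ?_ ?_)))))
      · filter_upwards [hsmall (half_pos hδ₀)] with δ h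
        linarith
      · exact hsmall (by positivity)
      · exact hsmall (by positivity)
      · simp only [Filter.eventually_all_finset]
        intro k hk p hp
        filter_upwards [hsmall (sub_pos.2 (hGr k (Nat.lt_succ_iff.1 (Finset.mem_range.1 hk)) p hp))]
          with δ h
        linarith
      · simp only [Filter.eventually_all_finset, Filter.eventually_all]
        intro i hi j hj p hp q hq hij
        have hpq : p ≠ q := by
          rintro rfl
          exact Finset.disjoint_left.1
            (hFdis i (Finset.mem_range.1 hi) j (Finset.mem_range.1 hj) hij) hp hq
        filter_upwards [hsmall (div_pos (dist_pos.2 hpq) (by norm_num : (0 : ℝ) < 5)),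
          self_mem_nhdsWithin] with δ h h0
        have h0' : 0 < δ := h0
        linarith
      · simp only [Filter.eventually_all_finset]
        intro i hi
        have h1 := c.one_le_e i (Finset.mem_range.1 hi)
        have : 1 / (c.e i + θ') < 1 / (c.e i + c.θ) :=
          one_div_lt_one_div_of_lt (by linarith) (by linarith)
        filter_upwards [hsmall (sub_pos.2 this)] with δ h
        linarith
    exact h.exists
  have hδG' : ∀ k ≤ c.R, ∀ p ∈ G k, dist p (c.pt k) + δ ≤ c.r := fun k hk =>
    hδG k (Finset.mem_range.2 (Nat.lt_succ_of_le hk))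
  obtain ⟨f, hf1, hf2, hf3⟩ := c.exists_spikes G hδ hGne hδG'
  set E : ℝ := max (max 4 N) ((2 * ‖f‖ + 1) / δ) with hE
  have hE4 : 4 ≤ E := (le_max_left _ _).trans (le_max_left _ _)
  have hEN : (N : ℝ) ≤ E := (le_max_right _ _).trans (le_max_left _ _)
  have hEf : 2 * ‖f‖ + 1 ≤ E * δ := by
    rw [← div_le_iff₀ hδ]; exact le_max_right _ _
  let ε : ℝ := min c.ω (min (c.μ / 2) (min (δ / 2) (1 / 2)))
  have hε : 0 < ε := by
    have := c.ω_pos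
    have := c.μ_pos
    simp only [ε, lt_min_iff]
    exact ⟨by linarith, by linarith, by linarith, by norm_num⟩
  have hball {f' : C(I, ℝ)} (h : f' ∈ Metric.ball f ε) (x : I) : |f' x - f x| < ε := by
    have := ContinuousMap.dist_apply_le_dist (f := f') (g := f) x
    rw [Real.dist_eq] at this
    exact this.trans_lt h
  have hsub : Metric.ball f ε ⊆ c.nbhd := fun f' hf' =>
    c.mem_nbhd_of_near hδ hGne hδG' hf1 hf2 hf3 fun x => (hball hf' x).le.trans (min_le_left _ _)
  have hfU : f ∈ c.nbhd := hsub (Metric.mem_ball_self hε)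
  let e : ℕ → ℝ := fun i => if i < c.N then c.e i else E
  have he1 {i} (hi : i < c.N) : e i = c.e i := if_pos hi
  have he2 {i} (hi : ¬ i < c.N) : e i = E := if_neg hi
  let b : Pinned :=
    { N := N
      F := F
      δ := δ
      e := e
      θ := θ'
      U := Metric.ball f ε
      δ_pos := hδ
      θ_nonneg := by linarith
      θ_lt := by linarith
      one_le_e := fun i hi => by
        by_cases h : i < c.N
        · rw [he1 h]; exact c.one_le_e i h
        · rw [he2 h]; linarith
      le_e := fun i hi => by
        by_cases h : i < c.N
        · rw [he1 h]; exact c.le_e i h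
        · rw [he2 h]
          have : (i : ℝ) ≤ N := by exact_mod_cast hi.le
          linarith
      isOpen_U := Metric.isOpen_ball
      U_nonempty := ⟨f, Metric.mem_ball_self hε⟩
      sep := fun i hi j hj hij p hp q hq =>
        hδsep i (Finset.mem_range.2 hi) j (Finset.mem_range.2 hj) p hp q hq hij
      forced := fun i hi p hp f' hf' => by
        by_cases h : i < c.N
        · -- an old label
          rw [he1 h]
          obtain ⟨y, hy, hpy⟩ := Set.mem_iUnion₂.1 ((hFV i h).1 hp)
          obtain ⟨k, hk, rfl, rfl⟩ := Loose.mem_centers.1 hy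
          have hpG : p ∈ G k := by
            rw [hGlab h]; exact Finset.mem_filter.2 ⟨hp, hpy⟩
          have hpr : dist p (c.pt k) ≤ c.r := (Metric.mem_ball.1 hpy).le
          obtain ⟨d, hd, hwin, hb⟩ := c.forced k hk h
          have hei := c.one_le_e _ h
          obtain ⟨x, hx, hxp⟩ := exists_mem_boundedAt_near (μ := min c.μ δ) (sgn_eq_or k) hd
            (by linarith : 0 < c.e (c.ℓ k) + θ') (p := p) (f := f) (f' := f')
            (by rw [mul_one_div]; exact hwin p hpr) hδ (hδe _ (Finset.mem_range.2 h))
            (fun y hy0 hy1 => by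
              rw [hf1 k hk p hpG]
              have hmono : (c.e (c.ℓ k) + c.θ) * (d * ((y : ℝ) - p)) ≤
                  (c.e (c.ℓ k) + θ') * (d * ((y : ℝ) - p)) :=
                mul_le_mul_of_nonneg_right (by linarith) (by linarith)
              by_cases hyr : dist y (c.pt k) ≤ c.r
              · have h1 := (hf3 k hk y hyr).2
                have h2 : δ ≤ (c.e (c.ℓ k) + θ') * (d * ((y : ℝ) - p)) := by
                  nlinarith
                have h3 := min_le_right c.μ δ
                linarith
              · have h1 := hb f hfU p y hpr (not_le.1 hyr) (by linarith) hy1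
                have h3 := min_le_left c.μ δ
                linarith)
            (fun y => (hball hf' y).trans_le (by
              rcases le_total c.μ δ with h' | h'
              · rw [min_eq_left h']
                exact (min_le_right _ _).trans (min_le_left _ _)
              · rw [min_eq_right h']
                exact (min_le_right _ _).trans ((min_le_right _ _).trans (min_le_left _ _))))
          exact ⟨x, ⟨_, d, sgn_eq_or k, hd, hx⟩, hxp.le⟩
        · -- a new label
          rw [he2 h]
          obtain ⟨d, hd, hwin⟩ : ∃ d : ℝ, (d = 1 ∨ d = -1) ∧
              (p : ℝ) + d * (1 / 2) ∈ Set.Icc (0 : ℝ) 1 := by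
            rcases le_total (p : ℝ) (1 / 2) with h' | h'
            · exact ⟨1, .inl rfl, by linarith [p.2.1], by linarith⟩
            · exact ⟨-1, .inr rfl, by linarith, by linarith [p.2.2]⟩
          have hcw : 1 / (E + θ') ≤ 1 / 4 := one_div_le_one_div_of_le (by norm_num) (by linarith)
          obtain ⟨x, hx, hxp⟩ := exists_mem_boundedAt_near (μ := 1) (.inl rfl) hd
            (by linarith : 0 < E + θ') (p := p) (f := f) (f' := f') hwin hδ (by linarith)
            (fun y hy0 hy1 => by
              have h1 := abs_le.1 (f.norm_coe_le_norm y)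
              have h2 := abs_le.1 (f.norm_coe_le_norm p)
              have h3 : E * δ ≤ (E + θ') * (d * ((y : ℝ) - p)) :=
                mul_le_mul (by linarith) hy0 hδ.le (by linarith)
              linarith [h1.2, h2.1])
            (fun y => (hball hf' y).trans_le
              ((min_le_right _ _).trans ((min_le_right _ _).trans (min_le_right _ _))))
          exact ⟨x, ⟨1, d, .inl rfl, hd, hx⟩, hxp.le⟩ }
  have hbV : b.V ⊆ W := hFW _ hδδ₀
  refine ⟨b, ⟨hsub, hbV.trans hWc, hN, fun i hi => he1 hi, hδN, ?_⟩, hbV⟩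
  intro f' hf' k hk hℓ x hx m hm hxb
  by_contra! hfar
  refine c.notMem_boundedSet (hsub hf') hm ?_ hxb
  rw [← hf2 x fun l hl p hp => ?_]
  · exact (hball hf' x).le.trans (min_le_left _ _)
  · by_cases hlk : l = k
    · subst hlk
      rw [hGlab hℓ] at hp
      exact (hfar p (Finset.mem_filter.1 hp).1).le
    · by_contra! hlt
      have h1 := hδG' l hl p hp
      have h2 := c.r_le'
      have h3 : 0 < 1 / (c.R : ℝ) := one_div_pos.2 c.R_pos'
      exact hlk (c.eq_of_dist_le hl hk (by linarith [dist_triangle x p (c.pt l)]) hx)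

lemma exists_osc_le (g : C(I, ℝ)) {κ : ℝ} (hκ : 0 < κ) :
    ∃ ρ > 0, ∀ x y : I, dist x y ≤ ρ → |g x - g y| ≤ κ := by
  obtain ⟨ρ, hρ, h⟩ := Metric.uniformContinuous_iff.1
    (CompactSpace.uniformContinuous_of_continuous g.continuous) κ hκ
  exact ⟨ρ / 2, half_pos hρ, fun x y hxy => (h (by linarith)).le⟩

/-- A frame inside a given open set, with a fine grid and very small balls. -/
lemma exists_frame {U : Set C(I, ℝ)} (hU : IsOpen U) (hne : U.Nonempty) (M : ℝ) (hM : 1 ≤ M)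
    {τ ε : ℝ} (hτ : 0 < τ) (hτ1 : τ ≤ 1) (hε : 0 < ε) :
    ∃ D : Frame, D.nbhd ⊆ U ∧ 3 * M / D.R < 1 ∧ 3 * M / D.R ≤ D.A / 8 ∧
      D.ω = τ / D.R / 32 ∧ D.r ≤ ε ∧ 4 * M * D.r ≤ τ / D.R / 32 ∧ 4 * D.r * M ^ 2 < τ ∧
      ∀ x y : I, dist x y ≤ 2 * D.r → |D.g x - D.g y| ≤ τ / D.R / 32 := by
  obtain ⟨g, hg⟩ := hne
  obtain ⟨A', hA', hball⟩ := Metric.isOpen_iff.1 hU g hg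
  set A : ℝ := A' / 3 with hA
  have hA0 : 0 < A := by positivity
  obtain ⟨ρ, hρ, hosc⟩ := exists_osc_le g (by positivity : 0 < A / 8)
  obtain ⟨R, hR⟩ := exists_nat_gt (max (3 / ρ) (max (3 * M) (24 * M / A)))
  have hR1 : 3 / ρ < R := (le_max_left _ _).trans_lt hR
  have hR2 : 3 * M < R := ((le_max_left _ _).trans (le_max_right _ _)).trans_lt hR
  have hR3 : 24 * M / A < R := ((le_max_right _ _).trans (le_max_right _ _)).trans_lt hR
  have hR0 : (0 : ℝ) < R := by linarith
  have hRA : 3 * M / R ≤ A / 8 := by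
    rw [div_lt_iff₀ hA0] at hR3
    rw [div_le_div_iff₀ hR0 (by norm_num)]
    linarith
  have hRρ : 3 / R ≤ ρ := by
    rw [div_lt_iff₀ hρ] at hR1
    rw [div_le_iff₀ hR0]
    linarith
  have hRinv : 1 / (R : ℝ) ≤ A / 24 := by
    have : 3 * 1 / (R : ℝ) ≤ 3 * M / R := by gcongr
    have e : 3 * 1 / (R : ℝ) = 3 * (1 / R) := by ring
    linarith
  have hω : τ / R / 32 ≤ A / 16 := by
    have : τ / R ≤ 1 / R := by gcongr
    linarith
  have hω0 : 0 < τ / R / 32 := by positivity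
  obtain ⟨ρ', hρ', hosc'⟩ := exists_osc_le g hω0
  have hM0 : 0 < M := by linarith
  obtain ⟨r, hr0, hr1, hr2, hr3, hr4, hr5⟩ : ∃ r > (0 : ℝ), r ≤ 1 / (32 * R) ∧ r ≤ ε ∧
      r ≤ τ / R / 32 / (4 * M) ∧ r ≤ τ / (8 * M ^ 2) ∧ r ≤ ρ' / 2 := by
    refine ⟨min (1 / (32 * R))
        (min ε (min (τ / R / 32 / (4 * M)) (min (τ / (8 * M ^ 2)) (ρ' / 2)))),
      ?_, min_le_left _ _, ?_, ?_, ?_, ?_⟩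
    · simp only [gt_iff_lt, lt_min_iff]
      exact ⟨by positivity, hε, by positivity, by positivity, by positivity⟩
    · exact (min_le_right _ _).trans (min_le_left _ _)
    · exact (min_le_right _ _).trans ((min_le_right _ _).trans (min_le_left _ _))
    · exact (min_le_right _ _).trans ((min_le_right _ _).trans ((min_le_right _ _).trans
        (min_le_left _ _)))
    · exact (min_le_right _ _).trans ((min_le_right _ _).trans ((min_le_right _ _).trans
        (min_le_right _ _)))
  let D : Frame :=
    { g := g, R := R, A := A, ω := τ / R / 32, r := r
      R_pos := by exact_mod_cast hR0
      A_pos := hA0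
      ω_pos := hω0
      r_pos := hr0
      ω_le := hω
      r_le := hr1
      osc := fun x y h => hosc x y (h.trans hRρ) }
  refine ⟨D, fun f hf => hball ?_, ?_, hRA, rfl, hr2, ?_, ?_, fun x y h => hosc' x y ?_⟩
  · have : dist f g ≤ 2 * A := D.dist_le_of_mem_nbhd hf
    rw [Metric.mem_ball]
    linarith
  · exact (div_lt_one hR0).2 hR2
  · rw [le_div_iff₀ (by positivity)] at hr3
    linarith
  · rw [le_div_iff₀ (by positivity)] at hr4
    change 4 * r * M ^ 2 < τ
    linarith
  · change dist x y ≤ 2 * r at h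
    linarith

/-- The side condition at an old spike of the loose position refining a pinned position. -/
lemma Frame.forced_of_mem_boundedAt (D : Frame) {k : ℕ} (hk : k ≤ D.R) {M τ c c' : ℝ}
    (hτ : 0 < τ) (hτ1 : τ ≤ 1) (hc : 1 ≤ c) (hcc' : c' = c + τ) (hc'M : c' ≤ M)
    (hω : D.ω = τ / D.R / 32) (hr1 : 4 * M * D.r ≤ τ / D.R / 32) (hr2 : 4 * D.r * M ^ 2 < τ)
    (hosc : ∀ x y : I, dist x y ≤ 2 * D.r → |D.g x - D.g y| ≤ τ / D.R / 32)
    {f₀ : C(I, ℝ)} (hf₀ : f₀ ∈ D.nbhd) {x : I} (hx : dist x (D.pt k) ≤ D.r) {d : ℝ}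
    (hd : d = 1 ∨ d = -1) (hxb : x ∈ boundedAt (sgn k) d c f₀) :
    (∀ p : I, dist p (D.pt k) ≤ D.r → (p : ℝ) + d / c' ∈ Set.Icc (0 : ℝ) 1) ∧
    ∀ f ∈ D.nbhd, ∀ p y : I, dist p (D.pt k) ≤ D.r → D.r < dist y (D.pt k) →
      0 ≤ d * ((y : ℝ) - p) → d * ((y : ℝ) - p) ≤ 1 / c' →
      sgn k * f y ≤ sgn k * D.g (D.pt k) + D.A + c' * (d * ((y : ℝ) - p)) - τ / D.R / 32 := by
  have hr := D.r_pos
  have hR := D.R_pos'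
  have hpos : 0 < 1 / (D.R : ℝ) := one_div_pos.2 hR
  have hrle := D.r_le'
  have hc0 : 0 < c := by linarith
  have hc0' : 0 < c' := by linarith
  have hgap : 1 / c' + 4 * D.r < 1 / c := by
    have h1 : 1 / c - 1 / c' = τ / (c * c') := by
      rw [hcc']; field_simp; ring
    have h2 : τ / M ^ 2 ≤ τ / (c * c') := by
      refine div_le_div_of_nonneg_left hτ.le (by positivity) ?_
      nlinarith
    have h3 : 4 * D.r < τ / M ^ 2 := by
      rw [lt_div_iff₀ (by nlinarith)]; exact hr2
    linarith
  have hdabs (a : ℝ) : |d * a| = |a| := by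
    rw [abs_mul]; rcases hd with rfl | rfl <;> simp
  have hpx {p : I} (hp : dist p (D.pt k) ≤ D.r) : |(p : ℝ) - x| ≤ 2 * D.r := by
    have h : dist p x ≤ 2 * D.r := (dist_triangle_right p x (D.pt k)).trans (by linarith)
    exact h
  obtain ⟨hxc, hxb⟩ := hxb
  refine ⟨fun p hp => ?_, fun f hf p y hp hy hy0 hy1 => ?_⟩
  · have h := abs_le.1 (hpx hp)
    have h0 : 0 < 1 / c' := one_div_pos.2 hc0'
    rcases hd with rfl | rfl
    · exact ⟨by linarith [p.2.1], by linarith [h.2, hxc.2]⟩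
    · rw [neg_div] at hxc ⊢
      exact ⟨by linarith [h.1, hxc.1], by linarith [p.2.2]⟩
  · have hτR : τ / D.R = τ * (1 / D.R) := by ring
    have hτR' : τ / D.R ≤ 1 / D.R := by
      rw [hτR]; nlinarith
    have hτR0 : 0 < τ / D.R := by positivity
    rcases le_or_gt (dist y (D.pt k)) (1 / D.R / 2) with hnear | hfar
    · have h1 := D.le_of_dist_le hf hk hy hnear
      have h2 : 0 ≤ c' * (d * ((y : ℝ) - p)) := mul_nonneg hc0'.le hy0
      have h3 := D.ω_le
      have := D.A_pos
      linarith
    · obtain ⟨z, hzy, hz⟩ := D.exists_near_le hf hf₀ (by positivity) hosc (sgn_eq_or k) y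
      have hyp : 1 / D.R / 4 + 4 * D.r < d * ((y : ℝ) - p) := by
        have h1 : |(y : ℝ) - p| = d * ((y : ℝ) - p) := by
          rw [← hdabs, abs_of_nonneg hy0]
        have h2 : dist y p = |(y : ℝ) - p| := rfl
        rw [← h1, ← h2]
        linarith [dist_triangle y p (D.pt k)]
      have e : d * ((z : ℝ) - x) = d * ((y : ℝ) - p) + d * ((z : ℝ) - y) + d * ((p : ℝ) - x) := by
        ring
      have h1 : |d * ((z : ℝ) - y)| ≤ 2 * D.r := by rw [hdabs]; exact hzy
      have h2 : |d * ((p : ℝ) - x)| ≤ 2 * D.r := by rw [hdabs]; exact hpx hp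
      have h1' := abs_le.1 h1
      have h2' := abs_le.1 h2
      have h3 := hxb z (by linarith [h1'.1, h2'.1]) (by linarith [h1'.2, h2'.2])
      have h4 : c * (d * ((z : ℝ) - x)) ≤ c * (d * ((y : ℝ) - p)) + 4 * M * D.r := by
        have : c * (d * ((z : ℝ) - x)) ≤ c * (d * ((y : ℝ) - p) + 4 * D.r) :=
          mul_le_mul_of_nonneg_left (by linarith [h1'.2, h2'.2]) hc0.le
        have : c * (4 * D.r) ≤ M * (4 * D.r) :=
          mul_le_mul_of_nonneg_right (by linarith) (by linarith)
        linarith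
      have h5 := ((hf₀.2 k hk).1 x hx).2
      have h6 : τ / D.R / 4 ≤ τ * (d * ((y : ℝ) - p)) := by
        have : τ * (1 / D.R / 4) ≤ τ * (d * ((y : ℝ) - p)) :=
          mul_le_mul_of_nonneg_left (by linarith) hτ.le
        calc τ / D.R / 4 = τ * (1 / D.R / 4) := by ring
          _ ≤ _ := this
      have h7 : c' * (d * ((y : ℝ) - p)) = c * (d * ((y : ℝ) - p)) + τ * (d * ((y : ℝ) - p)) := by
        rw [hcc']; ring
      rw [mul_sub] at h3
      linarith

/-- The side condition at a new spike of the loose position refining a pinned position. -/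
lemma Frame.forced_of_large (D : Frame) {k : ℕ} (hk : k ≤ D.R) {c : ℝ} (hc : 4 * (D.R : ℝ) ≤ c) :
    ∃ d : ℝ, (d = 1 ∨ d = -1) ∧
      (∀ p : I, dist p (D.pt k) ≤ D.r → (p : ℝ) + d / c ∈ Set.Icc (0 : ℝ) 1) ∧
      ∀ f ∈ D.nbhd, ∀ p y : I, dist p (D.pt k) ≤ D.r → D.r < dist y (D.pt k) →
        0 ≤ d * ((y : ℝ) - p) → d * ((y : ℝ) - p) ≤ 1 / c →
        sgn k * f y ≤ sgn k * D.g (D.pt k) + D.A + c * (d * ((y : ℝ) - p)) - D.ω := by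
  have hR := D.R_pos'
  have hR1 : 1 / (D.R : ℝ) ≤ 1 := by
    rw [div_le_one hR]; exact_mod_cast D.R_pos
  have hrle := D.r_le'
  have hc0 : 0 < c := by linarith
  have hcR : 1 / c ≤ 1 / D.R / 4 := by
    rw [div_div, mul_comm]
    exact one_div_le_one_div_of_le (by positivity) hc
  have hcpos : 0 < 1 / c := one_div_pos.2 hc0
  obtain ⟨d, hd, hwin⟩ : ∃ d : ℝ, (d = 1 ∨ d = -1) ∧
      ∀ p : I, dist p (D.pt k) ≤ D.r → (p : ℝ) + d / c ∈ Set.Icc (0 : ℝ) 1 := by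
    have hp' {p : I} (hp : dist p (D.pt k) ≤ D.r) :=
      abs_le.1 (show |(p : ℝ) - D.pt k| ≤ D.r from hp)
    rcases le_total (D.pt k : ℝ) (1 / 2) with h | h
    · exact ⟨1, .inl rfl, fun p hp => ⟨by linarith [p.2.1], by linarith [(hp' hp).2]⟩⟩
    · refine ⟨-1, .inr rfl, fun p hp => ?_⟩
      rw [neg_div]
      exact ⟨by linarith [(hp' hp).1], by linarith [p.2.2]⟩
  refine ⟨d, hd, hwin, fun f hf p y hp hy hy0 hy1 => ?_⟩
  have hyp : dist y p ≤ 1 / c := by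
    have h1 : |(y : ℝ) - p| = d * ((y : ℝ) - p) := by
      rw [← abs_of_nonneg hy0, abs_mul]; rcases hd with rfl | rfl <;> simp
    have h2 : dist y p = |(y : ℝ) - p| := rfl
    rw [h2, h1]; exact hy1
  have h1 := D.le_of_dist_le hf hk hy (by linarith [dist_triangle y p (D.pt k)])
  have h2 : 0 ≤ c * (d * ((y : ℝ) - p)) := mul_nonneg hc0.le hy0
  have h3 := D.ω_le
  have := D.A_pos
  linarith

/-- Every pinned position has a loose refinement. -/
theorem Pinned.exists_refinesPinned (b : Pinned) : ∃ c : Loose, RefinesPinned b c := by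
  classical
  obtain ⟨M, hM1, hMN, hMe⟩ : ∃ M : ℝ, 1 ≤ M ∧ (b.N : ℝ) + 1 ≤ M ∧ ∀ i < b.N, b.e i + 1 ≤ M := by
    have h : ∀ᶠ M : ℝ in atTop, 1 ≤ M ∧ (b.N : ℝ) + 1 ≤ M ∧
        ∀ i ∈ Finset.range b.N, b.e i + 1 ≤ M := by
      refine (eventually_ge_atTop _).and ((eventually_ge_atTop _).and ?_)
      rw [Filter.eventually_all_finset]
      exact fun i _ => eventually_ge_atTop _
    obtain ⟨M, h1, h2, h3⟩ := h.exists
    exact ⟨M, h1, h2, fun i hi => h3 i (Finset.mem_range.2 hi)⟩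
  have hδ := b.δ_pos
  have hθ0 := b.θ_nonneg
  have hθ1 := b.θ_lt
  set τ : ℝ := (1 - b.θ) / 2 with hτdef
  obtain ⟨D, hDU, hDM, hDMA, hω, hrε, hr1, hr2, hosc⟩ := exists_frame b.isOpen_U b.U_nonempty M hM1
    (by linarith : 0 < τ) (by linarith) (lt_min (by positivity : 0 < b.δ / 4)
      (by positivity : 0 < 1 / ((b.N : ℝ) + 2)))
  have hr := D.r_pos
  have hR := D.R_pos'
  have hrδ : D.r ≤ b.δ / 4 := hrε.trans (min_le_left _ _)
  have hle {c : ℝ} (h : c ≤ M) : 3 * c / D.R ≤ 3 * M / D.R := by gcongr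
  have hlt1 {c : ℝ} (h : c ≤ M) : 3 * c / D.R < 1 := (hle h).trans_lt hDM
  have hleA {c : ℝ} (h : c ≤ M) : 3 * c / D.R ≤ D.A / 8 := (hle h).trans hDMA
  let Lab : ℕ → ℕ → Prop := fun k i => i < b.N ∧
    (∃ p ∈ b.F i, ∀ x, dist x (D.pt k) ≤ D.r → dist x p < 2 * b.δ) ∧
    ∃ f ∈ D.nbhd, ∃ x ∈ boundedSet (b.e i + b.θ) f, dist x (D.pt k) ≤ D.r
  have hLabuniq {k i j} (hi : Lab k i) (hj : Lab k j) : i = j := by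
    by_contra hij
    obtain ⟨hiN, ⟨p, hp, hpk⟩, -⟩ := hi
    obtain ⟨hjN, ⟨q, hq, hqk⟩, -⟩ := hj
    have h1 := hpk (D.pt k) (by rw [dist_self]; exact hr.le)
    have h2 := hqk (D.pt k) (by rw [dist_self]; exact hr.le)
    have h3 := b.sep i hiN j hjN hij p hp q hq
    linarith [dist_triangle_left p q (D.pt k)]
  let ℓ : ℕ → ℕ := fun k => if h : ∃ i, Lab k i then h.choose else b.N
  have hℓ1 {k i} (h : Lab k i) : ℓ k = i := by
    have hex : ∃ i, Lab k i := ⟨i, h⟩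
    have : ℓ k = hex.choose := dif_pos hex
    rw [this]
    exact hLabuniq hex.choose_spec h
  have hℓ2 (k) : Lab k (ℓ k) ∨ ℓ k = b.N := by
    by_cases hex : ∃ i, Lab k i
    · obtain ⟨i, hi⟩ := hex
      left; rw [hℓ1 hi]; exact hi
    · right; exact dif_neg hex
  have hℓlt (k) : ℓ k < b.N + 1 := by
    rcases hℓ2 k with h | h
    · exact h.1.trans (Nat.lt_succ_self _)
    · rw [h]; exact Nat.lt_succ_self _
  have hnear {f : C(I, ℝ)} (hf : f ∈ D.nbhd) {i} (hi : i < b.N) {x : I}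
      (hx : x ∈ boundedSet (b.e i + b.θ) f) {p : I} (hp : p ∈ b.F i) (hxp : dist x p ≤ b.δ) :
      ∃ k ≤ D.R, ℓ k = i ∧ dist x (D.pt k) ≤ D.r ∧
        ∀ z, dist z (D.pt k) ≤ D.r → dist z p < 2 * b.δ := by
    have hei := b.one_le_e i hi
    have heM : b.e i + b.θ ≤ M := by linarith [hMe i hi]
    obtain ⟨k, hk, hxk⟩ := D.exists_dist_pt_lt hf (by linarith) (hlt1 heM) (hleA heM) hx
    have hin : ∀ z, dist z (D.pt k) ≤ D.r → dist z p < 2 * b.δ := fun z hz => by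
      linarith [dist_triangle z (D.pt k) p, dist_triangle_left (D.pt k) p x]
    exact ⟨k, hk, hℓ1 ⟨hi, ⟨p, hp, hin⟩, f, hf, x, hx, hxk.le⟩, hxk.le, hin⟩
  let E : ℝ := max (b.N : ℝ) (4 * D.R)
  have hER : 4 * (D.R : ℝ) ≤ E := le_max_right _ _
  have hEN : (b.N : ℝ) ≤ E := le_max_left _ _
  have hR1 : (1 : ℝ) ≤ D.R := by exact_mod_cast D.R_pos
  let e : ℕ → ℝ := fun i => if i < b.N then b.e i else E
  have he1 {i} (hi : i < b.N) : e i = b.e i := if_pos hi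
  have he2 : e b.N = E := if_neg (lt_irrefl _)
  have hcast : ((b.N + 1 : ℕ) : ℝ) ≤ M := by push_cast; exact hMN
  let c : Loose :=
    { D with
      N := b.N + 1
      ℓ := ℓ
      e := e
      θ := b.θ + τ
      μ := D.ω
      θ_nonneg := by linarith
      θ_lt := by linarith
      μ_pos := D.ω_pos
      one_le_e := fun i hi => by
        rcases Nat.lt_succ_iff_lt_or_eq.1 hi with h | rfl
        · rw [he1 h]; exact b.one_le_e i h
        · rw [he2]; linarith
      le_e := fun i hi => by
        rcases Nat.lt_succ_iff_lt_or_eq.1 hi with h | rfl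
        · rw [he1 h]; exact b.le_e i h
        · rw [he2]; exact hEN
      N_lt := hlt1 hcast
      N_le := hleA hcast
      forced := fun k hk _ => by
        rcases hℓ2 k with hlab | hnew
        · obtain ⟨hi, -, f₀, hf₀, x, ⟨σ, d, hσ, hd, hxb⟩, hxk⟩ := hlab
          have hei := b.one_le_e _ hi
          have heM : b.e (ℓ k) + b.θ ≤ M := by linarith [hMe _ hi]
          obtain rfl := D.eq_sgn_of_mem_boundedAt hf₀ hσ hd (by linarith) (hlt1 heM) (hleA heM)
            hk hxk hxb
          rw [he1 hi, hω]
          exact ⟨d, hd, D.forced_of_mem_boundedAt hk (by linarith) (by linarith) (by linarith)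
            (by ring) (by linarith [hMe _ hi]) hω hr1 hr2 hosc hf₀ hxk hd hxb⟩
        · rw [hnew, he2]
          exact D.forced_of_large hk (by linarith) }
  refine ⟨c, ⟨hDU, ?_, rfl, fun i hi => he1 hi, ?_, ?_, ?_⟩⟩
  · intro K hK i hi
    obtain ⟨h1, h2⟩ := hK i (hi.trans (Nat.lt_succ_self _))
    refine ⟨fun x hx => ?_, fun p hp => ?_⟩
    · obtain ⟨q, hq, hxq⟩ := Set.mem_iUnion₂.1 (h1 hx)
      obtain ⟨k, hk, hki, rfl⟩ := Loose.mem_centers.1 hq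
      have hlab : Lab k i := by
        rcases hℓ2 k with h | h
        · exact hki ▸ h
        · exact absurd (hki.symm.trans h) hi.ne
      obtain ⟨p, hp, hin⟩ := hlab.2.1
      exact Set.mem_biUnion (show p ∈ b.F i from hp) (hin x (Metric.mem_ball.1 hxq).le)
    · obtain ⟨f, hf⟩ := D.nbhd_nonempty
      obtain ⟨x, hx, hxp⟩ := b.forced i hi p hp f (hDU hf)
      obtain ⟨k, hk, hki, -, hin⟩ := hnear hf hi hx hp hxp
      obtain ⟨y, hyK, hy⟩ := h2 (c.pt k) (Loose.mem_centers.2 ⟨k, hk, hki, rfl⟩)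
      exact ⟨y, hyK, hin y (Metric.mem_ball.1 hy).le⟩
  · have e : ((c.N : ℝ) + 1) = b.N + 2 := by
      change (((b.N + 1 : ℕ) : ℝ) + 1) = b.N + 2
      push_cast; ring
    rw [e]
    exact hrε.trans (min_le_right _ _)
  · intro f hf m hm x hx
    have hmM : (m : ℝ) + 1 ≤ M := le_trans (by exact_mod_cast hm) hcast
    obtain ⟨k, hk, hxk⟩ := D.exists_dist_pt_lt hf (by positivity) (hlt1 hmM) (hleA hmM) hx
    exact ⟨k, hk, hℓlt k, hxk.le⟩
  · intro f hf i hi m hme x hx p hp hxp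
    obtain ⟨k, hk, hki, hxk, -⟩ := hnear hf hi
      (boundedSet_mono (by positivity) (by linarith) f hx) hp hxp
    exact ⟨k, hk, hki, hxk⟩

/-! ### The limit of a chain of positions -/

/-- If `f` and `K` lie in all the open sets of a chain of positions, then the set of non-knot
points of `f` is the union of the sets `K i`. -/
theorem nonKnot_eq_iUnion_of_chain {bs : ℕ → Pinned} {cs : ℕ → Loose}
    (hbc : ∀ t, RefinesPinned (bs t) (cs t)) (hcb : ∀ t, RefinesLoose (cs t) (bs (t + 1)))
    {f : C(I, ℝ)} (hf : ∀ t, f ∈ (bs t).U) {K : ℕ → Closeds I} (hK : ∀ t, K ∈ (bs t).V) :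
    nonKnot f = ⋃ i, (K i : Set I) := by
  have hfc (t) : f ∈ (cs t).nbhd := (hcb t).U_subset (hf (t + 1))
  have hKc (t) : K ∈ (cs t).V := (hcb t).V_subset (hK (t + 1))
  have hN1 (t) : (cs t).N = (bs t).N + 1 := (hbc t).N_eq
  have hN2 (t) : (cs t).N ≤ (bs (t + 1)).N := (hcb t).N_le
  have hNt (t) : t ≤ (bs t).N := by
    induction t with
    | zero => exact Nat.zero_le _
    | succ t ih => have := hN1 t; have := hN2 t; omega
  have hr (t) : (cs t).r ≤ 1 / ((t : ℝ) + 1) := by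
    refine (hbc t).r_le.trans (one_div_le_one_div_of_le (by positivity) ?_)
    have : t ≤ (cs t).N := by have := hN1 t; have := hNt t; omega
    have : (t : ℝ) ≤ (cs t).N := by exact_mod_cast this
    linarith
  have hδ (t) : (bs (t + 1)).δ ≤ 1 / ((t : ℝ) + 1) := by
    refine (hcb t).δ_le.trans (one_div_le_one_div_of_le (by positivity) ?_)
    have : t ≤ (bs (t + 1)).N := (Nat.le_succ t).trans (hNt (t + 1))
    have : (t : ℝ) ≤ (bs (t + 1)).N := by exact_mod_cast this
    linarith
  have hsmall {ε : ℝ} (hε : 0 < ε) : ∀ᶠ t : ℕ in atTop, 1 / ((t : ℝ) + 1) < ε :=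
    tendsto_one_div_add_atTop_nhds_zero_nat.eventually_lt_const hε
  rw [nonKnot_eq_iUnion_boundedSet]
  refine Set.Subset.antisymm (Set.iUnion_subset fun m x hx => ?_)
    (Set.iUnion_subset fun i x hx => ?_)
  · let Near : ℕ → ℕ → Prop := fun n i => i < (cs n).N ∧
      ∃ k ≤ (cs n).R, (cs n).ℓ k = i ∧ dist x ((cs n).pt k) ≤ (cs n).r
    have hmN {n} (hn : m ≤ n) : m + 1 ≤ (cs n).N := by
      have := hN1 n; have := hNt n; omega
    have hex {n} (hn : m ≤ n) : ∃ i, Near n i := by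
      obtain ⟨k, hk, hkN, hxk⟩ := (hbc n).exists_label f (hfc n) m (hmN hn) x hx
      exact ⟨_, hkN, k, hk, rfl, hxk⟩
    -- some label occurs infinitely often
    obtain ⟨i, hi⟩ : ∃ i, ∃ᶠ n in atTop, Near n i := by
      by_cases hbig : ∃ n ≥ m, ∃ i, Near n i ∧ (m : ℝ) + 1 ≤ (cs n).e i
      · obtain ⟨n₀, hn₀, i, hnear, he⟩ := hbig
        have hall : ∀ n ≥ n₀, Near n i ∧ (m : ℝ) + 1 ≤ (cs n).e i := by
          intro n hn
          induction n, hn using Nat.le_induction with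
          | base => exact ⟨hnear, he⟩
          | succ n hn ih =>
            obtain ⟨⟨hi, k, hk, rfl, hxk⟩, he⟩ := ih
            obtain ⟨p, hp, hxp⟩ := (hcb n).near f (hf (n + 1)) k hk hi x hxk m
              (hmN (hn₀.trans hn)) hx
            have hib : (cs n).ℓ k < (bs (n + 1)).N := hi.trans_le (hN2 n)
            have heb : (m : ℝ) + 1 ≤ (bs (n + 1)).e ((cs n).ℓ k) := by
              rw [(hcb n).e_eq _ hi]; exact he
            refine ⟨⟨by have := hN1 (n + 1); omega, ?_⟩, ?_⟩
            · exact (hbc (n + 1)).near f (hfc (n + 1)) _ hib m heb x hx p hp hxp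
            · rw [(hbc (n + 1)).e_eq _ hib]; exact heb
        exact ⟨i, ((eventually_ge_atTop n₀).mono fun n hn => (hall n hn).1).frequently⟩
      · push Not at hbig
        by_contra! hcon
        have hev : ∀ᶠ n in atTop, ∀ i ∈ Finset.range (m + 1), ¬ Near n i := by
          rw [Filter.eventually_all_finset]
          exact fun i _ => hcon i
        obtain ⟨n, hn, hnm⟩ := (hev.and (eventually_ge_atTop m)).exists
        obtain ⟨i, hi⟩ := hex hnm
        refine hn i (Finset.mem_range.2 ?_) hi
        have h1 := hbig n hnm i hi
        have h2 := (cs n).le_e i hi.1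
        have : (i : ℝ) < ((m + 1 : ℕ) : ℝ) := by push_cast; linarith
        exact_mod_cast this
    refine Set.mem_iUnion.2 ⟨i, ?_⟩
    rw [← (K i).isClosed.closure_eq, Metric.mem_closure_iff]
    intro ε hε
    obtain ⟨n, ⟨hiN, k, hk, hki, hxk⟩, hn⟩ := (hi.and_eventually (hsmall (half_pos hε))).exists
    obtain ⟨y, hyK, hy⟩ := (hKc n i hiN).2 ((cs n).pt k) (Loose.mem_centers.2 ⟨k, hk, hki, rfl⟩)
    refine ⟨y, hyK, ?_⟩
    linarith [dist_triangle_right x y ((cs n).pt k), Metric.mem_ball.1 hy, hr n]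
  · -- points of `K i` have a one-sided bound
    have he : ∀ n ≥ i + 1, i < (bs n).N ∧ (bs n).e i = (bs (i + 1)).e i := by
      intro n hn
      induction n, hn using Nat.le_induction with
      | base => exact ⟨hNt (i + 1), rfl⟩
      | succ n hn ih =>
        have h1 := hN1 n
        have h2 := hN2 n
        refine ⟨by omega, ?_⟩
        rw [(hcb n).e_eq i (by omega), (hbc n).e_eq i ih.1, ih.2]
    set e₀ : ℝ := (bs (i + 1)).e i
    have he₀ : 1 ≤ e₀ := (bs (i + 1)).one_le_e i (he _ le_rfl).1
    have hxb : x ∈ boundedSet (e₀ + 1) f := by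
      rw [← (isClosed_boundedSet (e₀ + 1) f).closure_eq, Metric.mem_closure_iff]
      intro ε hε
      obtain ⟨n, hn, hni⟩ := ((hsmall (by positivity : 0 < ε / 3)).and
        (eventually_ge_atTop (i + 1))).exists
      obtain ⟨hiN, hei⟩ := he (n + 1) (by omega)
      obtain ⟨p, hp, hxp⟩ := Set.mem_iUnion₂.1 ((hK (n + 1) i hiN).1 hx)
      obtain ⟨y, hy, hyp⟩ := (bs (n + 1)).forced i hiN p hp f (hf (n + 1))
      have h1 := (bs (n + 1)).θ_nonneg
      have h2 := (bs (n + 1)).θ_lt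
      rw [hei] at hy
      refine ⟨y, boundedSet_mono (by linarith) (by linarith) f hy, ?_⟩
      linarith [dist_triangle_right x y p, Metric.mem_ball.1 hxp, hδ n]
    obtain ⟨m, hm⟩ := exists_nat_ge e₀
    exact Set.mem_iUnion.2 ⟨m, boundedSet_mono (by linarith) (by linarith) f hxb⟩

/-! ### The initial positions and the theorem -/

/-- The pinned position without constraints. -/
def Pinned.start : Pinned where
  N := 0
  F := fun _ => ∅
  δ := 1
  e := fun _ => 0
  θ := 0
  U := Set.univ
  δ_pos := one_pos
  θ_nonneg := le_rfl
  θ_lt := one_pos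
  one_le_e := by simp
  le_e := by simp
  isOpen_U := isOpen_univ
  U_nonempty := Set.univ_nonempty
  sep := by simp
  forced := by simp

/-- A loose position without constraints on the closed sets. -/
noncomputable def Loose.start : Loose where
  g := 0
  R := 1
  A := 1
  ω := 1 / 16
  r := 1 / 32
  R_pos := one_pos
  A_pos := one_pos
  ω_pos := by norm_num
  r_pos := by norm_num
  ω_le := le_rfl
  r_le := by norm_num
  osc := by intros; simp
  N := 0
  ℓ := fun _ => 0
  e := fun _ => 0
  θ := 0
  μ := 1
  θ_nonneg := le_rfl
  θ_lt := one_pos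
  μ_pos := one_pos
  one_le_e := by simp
  le_e := by simp
  N_lt := by simp
  N_le := by simp
  forced := by simp

lemma Loose.start_V : Loose.start.V = Set.univ := by
  ext K; simp [V, vietoris, start]

lemma Loose.V_nonempty (c : Loose) : c.V.Nonempty :=
  ⟨_, ofFinset_mem_vietoris c.N c.centers c.r_pos⟩

lemma Pinned.V_nonempty (b : Pinned) : b.V.Nonempty :=
  ⟨_, ofFinset_mem_vietoris b.N b.F (mul_pos two_pos b.δ_pos)⟩

lemma RefinesLoose.restrict {c : Loose} {b : Pinned} (h : RefinesLoose c b) {W : Set C(I, ℝ)}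
    (hW : IsOpen W) (hne : W.Nonempty) (hsub : W ⊆ b.U) :
    RefinesLoose c (b.restrict W hW hne hsub) where
  U_subset := hsub.trans h.U_subset
  V_subset := h.V_subset
  N_le := h.N_le
  e_eq := h.e_eq
  δ_le := h.δ_le
  near := fun f hf => h.near f (hsub hf)

lemma RefinesPinned.of_restrict {b : Pinned} {c : Loose} {W : Set C(I, ℝ)} {hW : IsOpen W}
    {hne : W.Nonempty} {hsub : W ⊆ b.U} (h : RefinesPinned (b.restrict W hW hne hsub) c) :
    RefinesPinned b c where
  U_subset := h.U_subset.trans hsub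
  V_subset := h.V_subset
  N_eq := h.N_eq
  e_eq := h.e_eq
  r_le := h.r_le
  exists_label := h.exists_label
  near := h.near

lemma exists_seq_of_mem_residual {X : Type*} [TopologicalSpace X] {s : Set X}
    (h : s ∈ residual X) :
    ∃ G : ℕ → Set X, (∀ n, IsOpen (G n)) ∧ (∀ n, Dense (G n)) ∧ ⋂ n, G n ⊆ s := by
  obtain ⟨S, ho, hd, hc, hs⟩ := mem_residual_iff.1 h
  obtain ⟨G, hG⟩ := (hc.insert Set.univ).exists_eq_range (Set.insert_nonempty _ _)
  have hmem (n) : G n = Set.univ ∨ G n ∈ S := by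
    have : G n ∈ insert Set.univ S := hG ▸ Set.mem_range_self n
    exact this
  refine ⟨G, fun n => ?_, fun n => ?_, fun x hx => hs fun t ht => ?_⟩
  · rcases hmem n with h | h
    · rw [h]; exact isOpen_univ
    · exact ho _ h
  · rcases hmem n with h | h
    · rw [h]; exact dense_univ
    · exact hd _ h
  · have : t ∈ Set.range G := hG ▸ Set.mem_insert_of_mem _ ht
    obtain ⟨n, rfl⟩ := this
    exact Set.mem_iInter.1 hx n

/-- If residually many functions have their set of non-knot points in `S`, then residually many
sequences of closed sets have their union in `S`. -/
theorem residual_iUnion_mem {S : Set (Set I)}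
    (h : {f : C(I, ℝ) | nonKnot f ∈ S} ∈ residual C(I, ℝ)) :
    {K : ℕ → Closeds I | (⋃ n, (K n : Set I)) ∈ S} ∈ residual (ℕ → Closeds I) := by
  obtain ⟨G, hGo, hGd, hG⟩ := exists_seq_of_mem_residual h
  let P : ℕ → Loose → Loose → Prop := fun t c c' => ∃ b : Pinned, RefinesLoose c b ∧
    RefinesPinned b c' ∧ ∃ f : C(I, ℝ), ∃ ρ : ℝ, 0 < ρ ∧ ρ ≤ 1 / ((t : ℝ) + 1) ∧
      b.U = Metric.ball f ρ ∧ Metric.closedBall f ρ ⊆ c.nbhd ∩ G t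
  refine mem_of_superset (residual_exists_chain Loose.V P Loose.start Loose.start_V ?_) ?_
  · intro t c W hWc hW hne
    obtain ⟨b, hb, hbW⟩ := c.exists_refinesLoose hW hne hWc
    obtain ⟨f, hfU, hfG⟩ := (hGd t).inter_open_nonempty _ b.isOpen_U b.U_nonempty
    obtain ⟨ρ, hρ, hball⟩ := Metric.isOpen_iff.1 (b.isOpen_U.inter (hGo t)) f ⟨hfU, hfG⟩
    set ρ' : ℝ := min (ρ / 2) (1 / ((t : ℝ) + 1))
    have hρ' : 0 < ρ' := lt_min (by positivity) (by positivity)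
    have hcl : Metric.closedBall f ρ' ⊆ b.U ∩ G t := by
      refine Set.Subset.trans (fun x hx => ?_) hball
      have h1 : dist x f ≤ ρ' := hx
      have h2 : ρ' ≤ ρ / 2 := min_le_left _ _
      exact Metric.mem_ball.2 (by linarith)
    have hsub : Metric.ball f ρ' ⊆ b.U := fun x hx => (hcl (Metric.ball_subset_closedBall hx)).1
    let b' := b.restrict _ Metric.isOpen_ball ⟨f, Metric.mem_ball_self hρ'⟩ hsub
    have hb' : RefinesLoose c b' := hb.restrict _ _ _
    obtain ⟨c', hc'⟩ := b'.exists_refinesPinned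
    refine ⟨c', ⟨b', hb', hc', f, ρ', hρ', min_le_right _ _, rfl, fun x hx => ?_⟩,
      isOpen_vietoris _ _ _, c'.V_nonempty, hc'.V_subset.trans hbW⟩
    exact ⟨hb.U_subset (hcl hx).1, (hcl hx).2⟩
  · rintro K ⟨cs, -, hcs⟩
    choose bs h1 h2 fs ρ hρ hρt hU hcl using fun t => (hcs t).1
    have hanti (t) : Metric.closedBall (fs (t + 1)) (ρ (t + 1)) ⊆
        Metric.closedBall (fs t) (ρ t) := by
      intro x hx
      refine Metric.ball_subset_closedBall ?_
      rw [← hU t]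
      exact (h2 t).U_subset (hcl (t + 1) hx).1
    have hanti' : Antitone fun t => Metric.closedBall (fs t) (ρ t) := antitone_nat_of_succ_le hanti
    obtain ⟨f, hf⟩ : (⋂ t, Metric.closedBall (fs t) (ρ t)).Nonempty := by
      refine Metric.nonempty_iInter_of_nonempty_biInter (fun t => Metric.isClosed_closedBall)
        (fun t => Metric.isBounded_closedBall) (fun N => ?_) ?_
      · refine ⟨fs N, Set.mem_iInter₂.2 fun n hn => hanti' hn ?_⟩
        exact Metric.mem_closedBall_self (hρ N).le
      · refine squeeze_zero (fun t => Metric.diam_nonneg)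
          (fun t => (Metric.diam_closedBall (hρ t).le).trans
            (mul_le_mul_of_nonneg_left (hρt t) zero_le_two)) ?_
        simpa using tendsto_one_div_add_atTop_nhds_zero_nat.const_mul (2 : ℝ)
    rw [Set.mem_iInter] at hf
    have hfU (t) : f ∈ (bs t).U := (h2 t).U_subset (hcl (t + 1) (hf (t + 1))).1
    have hKV (t) : K ∈ (bs t).V := (h2 t).V_subset (hcs (t + 1)).2
    have key := nonKnot_eq_iUnion_of_chain h2 (fun t => h1 (t + 1)) hfU hKV
    have hfS : nonKnot f ∈ S := hG (Set.mem_iInter.2 fun t => (hcl t (hf t)).2)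
    exact show (⋃ n, (K n : Set I)) ∈ S from key ▸ hfS

/-- If residually many sequences of closed sets have their union in `S`, then residually many
functions have their set of non-knot points in `S`. -/
theorem residual_nonKnot_mem {S : Set (Set I)}
    (h : {K : ℕ → Closeds I | (⋃ n, (K n : Set I)) ∈ S} ∈ residual (ℕ → Closeds I)) :
    {f : C(I, ℝ) | nonKnot f ∈ S} ∈ residual C(I, ℝ) := by
  obtain ⟨G, hGo, hGd, hG⟩ := exists_seq_of_mem_residual h
  let P : ℕ → Pinned → Pinned → Prop := fun t b b' => ∃ c : Loose, RefinesPinned b c ∧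
    RefinesLoose c b' ∧ closure b'.V ⊆ c.V ∩ G t
  refine mem_of_superset (residual_exists_chain Pinned.U P Pinned.start rfl ?_) ?_
  · intro t b W hWb hW hne
    obtain ⟨c, hc⟩ := (b.restrict W hW hne hWb).exists_refinesPinned
    have hcV : IsOpen c.V := isOpen_vietoris _ _ _
    obtain ⟨K, hKV, hKG⟩ := (hGd t).inter_open_nonempty _ hcV c.V_nonempty
    obtain ⟨O, hO, hOcl, hOsub⟩ := exists_mem_nhds_isClosed_subset
      ((hcV.inter (hGo t)).mem_nhds ⟨hKV, hKG⟩)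
    obtain ⟨b', hb', hb'O⟩ := c.exists_refinesLoose (W := interior O) isOpen_interior
      ⟨K, mem_interior_iff_mem_nhds.2 hO⟩
      (interior_subset.trans (hOsub.trans Set.inter_subset_left))
    refine ⟨b', ⟨c, hc.of_restrict, hb', ?_⟩, b'.isOpen_U, b'.U_nonempty,
      hb'.U_subset.trans hc.U_subset⟩
    exact (closure_minimal (hb'O.trans interior_subset) hOcl).trans hOsub
  · rintro f ⟨bs, -, hbs⟩
    choose cs h1 h2 hcl using fun t => (hbs t).1
    have hsub (t) : closure (bs (t + 1)).V ⊆ (bs t).V := fun K hK =>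
      (h1 t).V_subset (hcl t hK).1
    obtain ⟨K, hK⟩ := IsCompact.nonempty_iInter_of_sequence_nonempty_isCompact_isClosed
      (fun t => closure (bs t).V) (fun t => (hsub t).trans subset_closure)
      (fun t => (bs t).V_nonempty.closure) isClosed_closure.isCompact (fun t => isClosed_closure)
    rw [Set.mem_iInter] at hK
    have key := nonKnot_eq_iUnion_of_chain h1 h2 (fun t => (hbs t).2) fun t => hsub t (hK (t + 1))
    have hKS : (⋃ n, (K n : Set I)) ∈ S := hG (Set.mem_iInter.2 fun t => (hcl t (hK (t + 1))).2)
    exact show nonKnot f ∈ S from key ▸ hKS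

end KnotPoints

theorem theorem2p4 (S : Set (Set KnotPoints.I)) :
    {f : C(KnotPoints.I, ℝ) | KnotPoints.nonKnot f ∈ S} ∈ residual C(KnotPoints.I, ℝ) ↔
      KnotPoints.ResidualFamily (S ∩ KnotPoints.Fsigma) := by
  have h : KnotPoints.ResidualFamily (S ∩ KnotPoints.Fsigma) ↔
      {K : ℕ → Closeds KnotPoints.I | (⋃ n, (K n : Set KnotPoints.I)) ∈ S} ∈
        residual (ℕ → Closeds KnotPoints.I) := by
    have : {K : ℕ → Closeds KnotPoints.I | (⋃ n, (K n : Set KnotPoints.I)) ∈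
        S ∩ KnotPoints.Fsigma} = {K | (⋃ n, (K n : Set KnotPoints.I)) ∈ S} := by
      ext K
      exact ⟨fun h => h.1, fun h => ⟨h, K, rfl⟩⟩
    rw [KnotPoints.ResidualFamily, this]
  rw [h]
  exact ⟨KnotPoints.residual_iUnion_mem, KnotPoints.residual_nonKnot_mem⟩
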